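/- Let $F$ be an algebraically closed field of characteristic zero, $G=\{g_1,\dots,g_s\}$ a finite abelian group, and $A=\bigoplus_{g\in G}A_g$ a finite dimensional associative $G$-graded algebra over $F$ (not assumed to have a unit) that is graded simple, i.e. $A^2\neq 0$ and the only graded two-sided ideals of $A$ are $0$ and $A$. Put $p_i=\dim_F A_{g_i}$ for $1\le i\le s$. Let $F\langle X,G\rangle$ be the free associative algebra on the variables $x_{n,g}$ ($n\in\mathbb{N}$, $g\in G$), where $x_{n,g}$ has degree $g$; a graded substitution replaces every variable of degree $g$ by an element of $A_g$, and a graded identity of $A$ is a polynomial that vanishes under all graded substitutions in $A$. Then for every integer $t\ge 1$ there are pairwise disjoint sets $X^j_{g_i}$ ($1\le j\le 2t$, $1\le i\le s$), where $X^j_{g_i}$ consists of $p_i$ variables of degree $g_i$, and a polynomial $\varphi\in F\langle X,G\rangle$ such that 1. $\varphi$ is multilinear in the variables of $\bigcup_{i,j}X^j_{g_i}$ (every monomial of $\varphi$ contains each of these variables exactly once and no other variable), and $\varphi$ is alternating in the variables of each set $X^j_{g_i}$ (a permutation $\sigma$ of the variables of that set multiplies $\varphi$ by $\operatorname{sgn}\sigma$);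 that is, $\varphi$ is $2t$-fold $(p_1,\dots,p_s)$-alternating; 2. $\varphi$ is not a graded identity of $A$; 3. some graded substitution in $A$ gives $\varphi$ a value that is central and invertible in $A$ (in particular, $A$ has an identity element). -/

import Mathlib

namespace GradedPI

/-! ### Graded algebras

Algebras are associative and need not have a unit: an `F`-algebra is a `NonUnitalRing A` with
`[Module F A] [IsScalarTower F A A] [SMulCommClass F A A]`.
-/

section Graded

variable {F G A : Type*} [Field F] [Group G] [DecidableEq G] [NonUnitalRing A] [Module F A]

/-- `A = ⨁_{g ∈ G} A_g` as a vector space, with `A_g A_h ⊆ A_{gh}`. -/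
structure IsGrading (𝒜 : G → Submodule F A) : Prop where
  isInternal : DirectSum.IsInternal 𝒜
  mul_mem : ∀ ⦃g h : G⦄ ⦃a b : A⦄, a ∈ 𝒜 g → b ∈ 𝒜 h → a * b ∈ 𝒜 (g * h)

/-- A graded ideal: a subspace `I` closed under multiplication by `A` on both sides, with
`I = ∑_g I ∩ A_g`. -/
structure IsGradedIdeal (𝒜 : G → Submodule F A) (I : Submodule F A) : Prop where
  mul_mem_left : ∀ (a : A) ⦃x : A⦄, x ∈ I → a * x ∈ I
  mul_mem_right : ∀ (a : A) ⦃x : A⦄, x ∈ I → x * a ∈ I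
  homogeneous : I = ⨆ g, I ⊓ 𝒜 g

/-- `G`-graded simple: `A² ≠ 0`, and the only graded ideals are `0` and `A`. -/
structure IsGradedSimple (𝒜 : G → Submodule F A) : Prop where
  exists_mul_ne_zero : ∃ a b : A, a * b ≠ 0
  eq_bot_or_eq_top : ∀ I : Submodule F A, IsGradedIdeal 𝒜 I → I = ⊥ ∨ I = ⊤

/-- The `G`-dimension `(dim A_g)_{g ∈ G}`. -/
noncomputable def gDim (𝒜 : G → Submodule F A) (g : G) : ℕ :=
  Module.finrank F (𝒜 g)

end Graded

/-- `z` is invertible in `A`: the algebra `A` has an identity element `e`, and `z` has a two-sided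
inverse with respect to it. -/
def IsInvertible {A : Type*} [Mul A] (z : A) : Prop :=
  ∃ e : A, (∀ a : A, e * a = a ∧ a * e = a) ∧ ∃ w : A, z * w = e ∧ w * z = e

/-! ### Graded polynomials -/

/-- The variables: `(g, n)` is the `n`-th variable of homogeneous degree `g`. -/
abbrev Var (G : Type*) := G × ℕ

/-- The free associative `G`-graded algebra `F⟨X, G⟩` (without constant terms): its monomials are
the nonempty words in the variables. -/
abbrev GradedPoly (F G : Type*) [Field F] := MonoidAlgebra F (FreeSemigroup (Var G))

section Poly

variable {F G : Type*} [Field F]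

/-- The variable `x` as a polynomial. -/
noncomputable def var (x : Var G) : GradedPoly F G :=
  MonoidAlgebra.single (FreeSemigroup.of x) 1

/-- Substituting the element `ρ x` of an algebra for every variable `x`. -/
noncomputable def eval {B : Type*} [NonUnitalRing B] [Module F B] [IsScalarTower F B B]
    [SMulCommClass F B B] (ρ : Var G → B) : GradedPoly F G →ₙₐ[F] B :=
  MonoidAlgebra.liftMagma F (FreeSemigroup.lift ρ)

/-- Renaming the variables by a permutation. -/
noncomputable def rename (σ : Equiv.Perm (Var G)) : GradedPoly F G →ₙₐ[F] GradedPoly F G :=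
  eval fun x => var (σ x)

/-- `f` is multilinear in the variables of the finite set `V`: it is a linear combination of
monomials in which every variable of `V` occurs exactly once, and no other variable occurs. -/
def IsMultilinear (V : Finset (Var G)) (f : GradedPoly F G) : Prop :=
  f ∈ Submodule.span F {p : GradedPoly F G | ∃ w : FreeSemigroup (Var G),
    ((w.head :: w.tail : List (Var G)) : Multiset (Var G)) = V.val ∧ p = MonoidAlgebra.single w 1}

/-- `f` is alternating in the variables of the finite set `S`: every permutation `σ` of `S`
multiplies `f` by `sgn σ`. -/
def IsAlternating [DecidableEq G] (S : Finset (Var G)) (f : GradedPoly F G) : Prop :=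
  ∀ σ : Equiv.Perm S, rename (Equiv.Perm.ofSubtype σ) f = (Equiv.Perm.sign σ : ℤ) • f

/-- `f` is `t`-fold `(m_g)_{g ∈ G}`-alternating with respect to the sets of variables `X j g`
(for `j = 1, …, t` and `g ∈ G`), where `X j g` consists of `m g` variables of degree `g`, and
the finite set `Y` of remaining variables. -/
structure IsFoldAlternating [DecidableEq G] [Fintype G] (t : ℕ) (m : G → ℕ)
    (X : Fin t → G → Finset (Var G)) (Y : Finset (Var G)) (f : GradedPoly F G) : Prop where
  degree : ∀ j g, ∀ x ∈ X j g, x.1 = g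
  card : ∀ j g, (X j g).card = m g
  disjoint : ∀ i j g, i ≠ j → Disjoint (X i g) (X j g)
  disjoint_rest : ∀ j g, Disjoint (X j g) Y
  multilinear : IsMultilinear (((Finset.univ : Finset (Fin t × G)).biUnion fun p => X p.1 p.2) ∪ Y) f
  alternating : ∀ j g, IsAlternating (X j g) f

variable {A : Type*} [NonUnitalRing A] [Module F A]

/-- A graded substitution: every variable of degree `g` goes to an element of `A_g`. -/
def IsGradedSubst (𝒜 : G → Submodule F A) (ρ : Var G → A) : Prop :=
  ∀ x : Var G, ρ x ∈ 𝒜 x.1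

/-- `f` is a graded identity of `A`: it vanishes under all graded substitutions. -/
def IsGradedIdentity [IsScalarTower F A A] [SMulCommClass F A A] (𝒜 : G → Submodule F A)
    (f : GradedPoly F G) : Prop :=
  ∀ ρ : Var G → A, IsGradedSubst 𝒜 ρ → eval ρ f = 0

end Poly

end GradedPI

set_option linter.unusedSectionVars false
set_option linter.unusedSimpArgs false

namespace GradedPI

open Equiv Finset

/-! A finite dimensional graded simple algebra satisfies `A = A²`, hence has a surjection `p` onto a
matrix algebra `M_n(F)`. The kernel of `p` contains no nonzero homogeneous element, so identities
between homogeneous elements can be checked in `M_n(F)`; in particular a homogeneous element with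
nonzero scalar image is central and invertible (`mem_center_and_isInvertible`). It remains to find a
polynomial, alternating as required, with such a value.

Let `K` be the group of periods of the family `p(A_g)`. Components in distinct cosets of `K` are
independent (`matComponent_independent`), so `M_n(F)` has a basis `b` of images of homogeneous
elements, and its lifts in the degrees `d a * k`, `k ∈ K`, enumerate bases of all `A_g`
(`exists_homogeneous_basis`). For fixed `k`, the `n²` variables of degrees `d a * k` thus specialize
to a basis of `M_n(F)`. The polynomial is a product, over `k ∈ K` and `t` pairs of copies, of
polynomials that alternate in two sets of `n²` variables and take a nonzero scalar value on every
basis of `M_n(F)` (`exists_word_regevSum_eq_scalar`).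

A doubly alternating polynomial of this kind is automatically scalar on a basis; the difficulty is a
word for which the trace is not zero. The alternating sum of tensor products of matrix units is a
`GL_n`-invariant tensor, hence a combination of permutations of the factors (`exists_perm_coeff`),
and so some `altTrace κ π` is nonzero. No odd permutation commutes with such a `π`: its cycles have
distinct odd lengths with sum `n²`, so there are at most `n` of them. Take `π` with the fewest
cycles and contract all factors except one in each cycle. A nontrivial permutation of the remaining
factors would merge cycles, so the contracted tensor has trace zero against it. Its coefficients are
therefore a nonzero multiple of the Weingarten function, which has no zeros on at most `n` points
(`weingarten_ne_zero`). Joining two copies of `π` at the chosen points by a full cycle `ρ` gives one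
cycle through all `2n²` positions, that is, a word; its trace is the coefficient at `ρ` times a
nonzero constant (`exists_doubleAltTrace_ne_zero`). -/

/-- The number of functions `α → κ` that are invariant under `σ`; it equals `|κ| ^ c`, where `c` is
the number of cycles of `σ`. -/
def numInvariant (κ : Type*) [Fintype κ] [DecidableEq κ] {α : Type*} [Fintype α] [DecidableEq α]
    (σ : Perm α) : ℕ :=
  (univ.filter fun a : α → κ => a ∘ σ = a).card

/-! ### Jucys–Murphy factorization and positivity of the signed Weingarten function -/

section Weingarten

/-- A permutation of `Fin m` as a permutation of `Fin (m + 1)` that fixes `0`. -/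
def shiftPerm {m : ℕ} (e : Perm (Fin m)) : Perm (Fin (m + 1)) := Perm.decomposeFin.symm (0, e)

@[simp] lemma shiftPerm_zero {m : ℕ} (e : Perm (Fin m)) : shiftPerm e 0 = 0 := by simp [shiftPerm]

@[simp] lemma shiftPerm_succ {m : ℕ} (e : Perm (Fin m)) (i : Fin m) :
    shiftPerm e i.succ = (e i).succ := by simp [shiftPerm]

lemma shiftPerm_mul {m : ℕ} (e f : Perm (Fin m)) :
    shiftPerm (e * f) = shiftPerm e * shiftPerm f := by
  ext i; refine Fin.cases ?_ (fun i => ?_) i <;> simp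

lemma shiftPerm_one {m : ℕ} : shiftPerm (1 : Perm (Fin m)) = 1 := by
  ext i; refine Fin.cases ?_ (fun i => ?_) i <;> simp

lemma shiftPerm_inv {m : ℕ} (e : Perm (Fin m)) : shiftPerm e⁻¹ = (shiftPerm e)⁻¹ := by
  rw [eq_inv_iff_mul_eq_one, ← shiftPerm_mul, inv_mul_cancel, shiftPerm_one]

lemma decomposeFin_symm_eq {m : ℕ} (p : Fin (m + 1)) (e : Perm (Fin m)) :
    Perm.decomposeFin.symm (p, e) = swap 0 p * shiftPerm e := by
  ext i; refine Fin.cases ?_ (fun i => ?_) i <;> simp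

lemma comp_shiftPerm_eq_iff {κ : Type*} {m : ℕ} (e : Perm (Fin m)) (a : Fin (m + 1) → κ) :
    a ∘ shiftPerm e = a ↔ (fun i => a (Fin.succ i)) ∘ e = fun i => a (Fin.succ i) := by
  constructor
  · intro h; ext i; simpa using congrFun h i.succ
  · intro h; ext i; refine Fin.cases ?_ (fun i => ?_) i
    · simp
    · simpa using congrFun h i

/-- The new fixed point is a cycle of its own, with a free value. -/
lemma numInvariant_shiftPerm (n : ℕ) {m : ℕ} (e : Perm (Fin m)) :
    numInvariant (Fin n) (shiftPerm e) = n * numInvariant (Fin n) e := by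
  unfold numInvariant
  have : n * (univ.filter fun a : Fin m → Fin n => a ∘ e = a).card =
      ((univ : Finset (Fin n)) ×ˢ (univ.filter fun a : Fin m → Fin n => a ∘ e = a)).card := by
    rw [card_product]; simp
  rw [this]
  refine card_bij' (fun a _ => (a 0, fun i => a (Fin.succ i))) (fun x _ => Fin.cons x.1 x.2)
    ?_ ?_ ?_ ?_
  · intro a ha
    simp only [mem_filter, mem_univ, true_and, mem_product] at ha ⊢
    exact (comp_shiftPerm_eq_iff e a).1 ha
  · intro x hx
    simp only [mem_filter, mem_univ, true_and, mem_product] at hx ⊢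
    rw [comp_shiftPerm_eq_iff]; simpa using hx
  · intro a _; exact Fin.cons_self_tail a
  · intro x _; simp

/-- The transposition inserts `0` into the cycle of `p`, so the value at `0` is forced and no factor
`n` appears. -/
lemma numInvariant_swap_mul_shiftPerm (n : ℕ) {m : ℕ} {p : Fin (m + 1)} (hp : p ≠ 0)
    (e : Perm (Fin m)) :
    numInvariant (Fin n) (swap 0 p * shiftPerm e) = numInvariant (Fin n) e := by
  obtain ⟨p, rfl⟩ := Fin.exists_succ_eq.2 hp
  have key : ∀ a : Fin (m + 1) → Fin n, a ∘ (swap 0 p.succ * shiftPerm e) = a ↔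
      a 0 = a p.succ ∧ a ∘ shiftPerm e = a := by
    intro a
    have hs : a 0 = a p.succ → a ∘ swap 0 p.succ = a := by
      intro h; ext i; simp only [Function.comp_apply, swap_apply_def]
      split_ifs with h1 h2 <;> simp_all
    have hc : a ∘ (swap 0 p.succ * shiftPerm e) = (a ∘ swap 0 p.succ) ∘ shiftPerm e := rfl
    constructor
    · intro h
      have h0 := congrFun h 0
      simp at h0
      refine ⟨h0.symm, ?_⟩
      rwa [hc, hs h0.symm] at h
    · rintro ⟨h0, h⟩
      rw [hc, hs h0, h]
  unfold numInvariant
  refine card_bij' (fun a _ i => a (Fin.succ i)) (fun x _ => Fin.cons (x p) x) ?_ ?_ ?_ ?_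
  · intro a ha
    simp only [mem_filter, mem_univ, true_and] at ha ⊢
    exact (comp_shiftPerm_eq_iff e a).1 ((key a).1 ha).2
  · intro x hx
    simp only [mem_filter, mem_univ, true_and] at hx ⊢
    rw [key, comp_shiftPerm_eq_iff]; simpa using hx
  · intro a ha
    simp only [mem_filter, mem_univ, true_and] at ha
    ext i; refine Fin.cases ?_ (fun i => ?_) i
    · simp [((key a).1 ha).1]
    · simp
  · intro x _; ext i; simp

/-- Convolution of `v` with the signed count of invariant functions. -/
def signedConv (n : ℕ) {m : ℕ} (v : Perm (Fin m) → ℚ) (π : Perm (Fin m)) : ℚ :=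
  ∑ g, v (π * g⁻¹) * ((Perm.sign g : ℤ) * numInvariant (Fin n) g : ℚ)

/-- Right multiplication by `n - ∑_{p ≠ 0} (0 p)`. -/
def jucysMul (n : ℕ) {m : ℕ} (v : Perm (Fin (m + 1)) → ℚ) (π : Perm (Fin (m + 1))) : ℚ :=
  n * v π - ∑ p : Fin m, v (π * swap 0 p.succ)

/-- Each permutation is uniquely `(0 p)` times one fixing `0`. For `p = 0` the count gains a factor
`n`, for `p ≠ 0` only the sign changes; hence the factor `n - ∑ (0 p)` splits off and a convolution
on the coset of the smaller group remains. -/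
lemma signedConv_succ (n : ℕ) {m : ℕ} (v : Perm (Fin (m + 1)) → ℚ) (π : Perm (Fin (m + 1)))
    (h : Perm (Fin m)) :
    signedConv n v (π * shiftPerm h) =
      signedConv n (fun e => jucysMul n v (π * shiftPerm e)) h := by
  unfold signedConv
  rw [← (Perm.decomposeFin (n := m)).symm.sum_comp, Fintype.sum_prod_type, Finset.sum_comm]
  refine sum_congr rfl fun e _ => ?_
  rw [Fin.sum_univ_succ]
  unfold jucysMul
  rw [sub_mul, sum_mul, sub_eq_add_neg, ← sum_neg_distrib]
  congr 1
  · rw [decomposeFin_symm_eq, swap_self, show (Equiv.refl (Fin (m + 1))) = 1 from rfl, one_mul,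
      numInvariant_shiftPerm, shiftPerm_mul, shiftPerm_inv, mul_assoc π]
    have : Perm.sign (shiftPerm e) = Perm.sign e := by simp [shiftPerm]
    rw [this]; push_cast; ring
  · refine sum_congr rfl fun p _ => ?_
    rw [decomposeFin_symm_eq, numInvariant_swap_mul_shiftPerm n (Fin.succ_ne_zero p)]
    have : Perm.sign (shiftPerm e) = Perm.sign e := by simp [shiftPerm]
    rw [Perm.sign_mul, this, Perm.sign_swap (Fin.succ_ne_zero p).symm, shiftPerm_mul,
      shiftPerm_inv, mul_inv_rev, swap_inv]
    simp only [mul_assoc]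
    push_cast; ring

/-- Minimum principle: at a minimum of `v` the hypothesis gives `(n - m) * v ≥ 0`, and `m < n`. -/
lemma nonneg_of_jucysMul_nonneg {n m : ℕ} (hm : m + 1 ≤ n) {v : Perm (Fin (m + 1)) → ℚ}
    (h : ∀ π, 0 ≤ jucysMul n v π) : ∀ π, 0 ≤ v π := by
  obtain ⟨π₀, -, hπ₀⟩ := exists_min_image univ v univ_nonempty
  have h1 : ∑ p : Fin m, v π₀ ≤ ∑ p : Fin m, v (π₀ * swap 0 p.succ) :=
    sum_le_sum fun p _ => hπ₀ _ (mem_univ _)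
  have h2 := h π₀
  unfold jucysMul at h2
  simp only [sum_const, card_univ, Fintype.card_fin, nsmul_eq_mul] at h1
  have h3 : (m : ℚ) + 1 ≤ n := by exact_mod_cast hm
  have h4 : 0 ≤ v π₀ := by
    by_contra hneg
    push Not at hneg
    nlinarith
  exact fun π => h4.trans (hπ₀ π (mem_univ _))

lemma exists_shiftPerm_or_swap {m : ℕ} (π τ : Perm (Fin (m + 1))) :
    (∃ e, τ = π * shiftPerm e) ∨ ∃ e, ∃ p : Fin m, τ = π * shiftPerm e * swap 0 p.succ := by
  obtain ⟨⟨p, e⟩, h⟩ := Perm.decomposeFin.symm.surjective (τ⁻¹ * π)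
  rw [decomposeFin_symm_eq] at h
  have hτ : τ = π * shiftPerm e⁻¹ * swap 0 p := by
    rw [shiftPerm_inv, ← swap_inv 0 p, mul_assoc, ← mul_inv_rev, h]; group
  rcases eq_or_ne p 0 with rfl | hp
  · left; exact ⟨e⁻¹, by rw [hτ, swap_self]; rfl⟩
  · obtain ⟨p, rfl⟩ := Fin.exists_succ_eq.2 hp
    exact Or.inr ⟨e⁻¹, p, hτ⟩

/-- If `m ≤ n`, then convolution with the signed count of invariant functions to `Fin n` is an
M-matrix whose inverse has positive entries. -/
theorem pos_of_signedConv {n m : ℕ} (hm : m ≤ n) (v : Perm (Fin m) → ℚ)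
    (h : ∀ π, 0 ≤ signedConv n v π) :
    (∀ π, 0 ≤ v π) ∧ ((∃ π, 0 < signedConv n v π) → ∀ π, 0 < v π) := by
  induction m with
  | zero =>
    have key : ∀ π, signedConv n v π = v π := by
      intro π
      obtain rfl := Subsingleton.elim 1 π
      simp [signedConv, numInvariant]
    simp only [key] at h ⊢
    refine ⟨h, ?_⟩
    rintro ⟨π, hπ⟩ π'
    rwa [Subsingleton.elim π' π]
  | succ m ih =>
    have ih' := fun π => ih (Nat.le_of_succ_le hm) (fun e => jucysMul n v (π * shiftPerm e))
      fun e => by rw [← signedConv_succ]; exact h _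
    have hy : ∀ π, 0 ≤ jucysMul n v π := fun π => by
      simpa [shiftPerm_one] using (ih' π).1 1
    have hv := nonneg_of_jucysMul_nonneg hm hy
    have hn : (0 : ℚ) < n := by exact_mod_cast (Nat.succ_pos m).trans_le hm
    refine ⟨hv, ?_⟩
    rintro ⟨π, hπ⟩ τ
    have hpos : ∀ e, 0 < jucysMul n v (π * shiftPerm e) :=
      (ih' π).2 ⟨1, by rw [← signedConv_succ]; simpa [shiftPerm_one] using hπ⟩
    have hpos' : ∀ e, 0 < v (π * shiftPerm e) := by
      intro e
      have h1 := hpos e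
      unfold jucysMul at h1
      have h2 : 0 ≤ ∑ p : Fin m, v (π * shiftPerm e * swap 0 p.succ) :=
        sum_nonneg fun p _ => hv _
      by_contra h3
      push Not at h3
      nlinarith
    rcases exists_shiftPerm_or_swap π τ with ⟨e, rfl⟩ | ⟨e, p, rfl⟩
    · exact hpos' e
    -- Positivity spreads from the coset of `π` to its neighbours: the summand with `q = p` returns
    -- to `π * shiftPerm e`, where `v` is positive.
    · have h1 := hy (π * shiftPerm e * swap 0 p.succ)
      unfold jucysMul at h1
      have h2 := single_le_sum (f := fun q : Fin m =>
        v (π * shiftPerm e * swap 0 p.succ * swap 0 q.succ)) (fun q _ => hv _) (mem_univ p)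
      simp only [mul_assoc, swap_mul_self, mul_one] at h1 h2 ⊢
      have h3 := hpos' e
      by_contra h4
      push Not at h4
      nlinarith

end Weingarten

/-! ### Double centralizer theorem -/

section DoubleCentralizer

/-- The double centralizer theorem for a representation of a finite group. -/
theorem exists_asAlgebraHom_eq {k G V : Type*} [Field k] [CharZero k] [Group G] [Finite G]
    [AddCommGroup V] [Module k V] [FiniteDimensional k V] (ρ : Representation k G V)
    (T : V →ₗ[k] V)
    (hT : ∀ φ : V →ₗ[k] V, (∀ g v, φ (ρ g v) = ρ g (φ v)) → ∀ v, T (φ v) = φ (T v)) :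
    ∃ r : MonoidAlgebra k G, T = ρ.asAlgebraHom r := by
  classical
  have : NeZero (Nat.card G : k) := ⟨by exact_mod_cast Nat.card_pos.ne'⟩
  -- The hypothesis says that `T` is linear over the commutant of the group algebra. The module is
  -- semisimple by Maschke, so Jacobson density, applied to a finite basis, realizes `T` by one
  -- element of the group algebra.
  let f : Module.End (Module.End (MonoidAlgebra k G) ρ.asModule) ρ.asModule :=
    { toFun := fun v => ρ.asModuleEquiv.symm (T (ρ.asModuleEquiv v))
      map_add' := fun v w => by simp
      map_smul' := fun φ v => by
        let φ' : V →ₗ[k] V := ρ.asModuleEquiv.toLinearMap ∘ₗ (φ.restrictScalars k) ∘ₗ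
          ρ.asModuleEquiv.symm.toLinearMap
        have h := hT φ' (fun g w => by
          simp only [φ', LinearMap.comp_apply, LinearEquiv.coe_coe, LinearMap.restrictScalars_apply]
          rw [ρ.asModuleEquiv_symm_map_rho, map_smul, ρ.asModuleEquiv_map_smul]
          simp) (ρ.asModuleEquiv v)
        simp only [φ', LinearMap.comp_apply, LinearEquiv.coe_coe,
          LinearMap.restrictScalars_apply, LinearEquiv.symm_apply_apply] at h
        simp only [Module.End.smul_def, RingHom.id_apply]
        rw [h, LinearEquiv.symm_apply_apply] }
  let b := Module.finBasis k V
  obtain ⟨r, hr⟩ := jacobson_density f (univ.image fun i => ρ.asModuleEquiv.symm (b i))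
  refine ⟨r, b.ext fun i => ?_⟩
  have h := hr (ρ.asModuleEquiv.symm (b i)) (mem_image_of_mem _ (mem_univ i))
  have h2 := congrArg ρ.asModuleEquiv h
  rw [ρ.asModuleEquiv_map_smul] at h2
  simpa [f] using h2

end DoubleCentralizer

/-! ### Schur–Weyl duality and the first fundamental theorem for matrices -/

section TensorPower

variable {ι κ R : Type*} [Fintype ι] [DecidableEq ι] [Fintype κ] [DecidableEq κ] [CommRing R]

/-- The Kronecker product of a family of matrices. -/
def kroneckerFamily (x : ι → Matrix κ κ R) : Matrix (ι → κ) (ι → κ) R :=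
  Matrix.of fun f g => ∏ i, x i (f i) (g i)

lemma kroneckerFamily_apply (x : ι → Matrix κ κ R) (f g : ι → κ) :
    kroneckerFamily x f g = ∏ i, x i (f i) (g i) := rfl

lemma kroneckerFamily_mul (x y : ι → Matrix κ κ R) :
    kroneckerFamily x * kroneckerFamily y = kroneckerFamily fun i => x i * y i := by
  ext f g
  simp only [Matrix.mul_apply, kroneckerFamily_apply, ← prod_mul_distrib]
  rw [Finset.prod_univ_sum]
  simp

lemma kroneckerFamily_one : kroneckerFamily (fun _ : ι => (1 : Matrix κ κ R)) = 1 := by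
  ext f g
  simp only [kroneckerFamily_apply, Matrix.one_apply]
  rw [Finset.prod_ite_zero]
  simp [funext_iff]

/-- The permanent by inclusion and exclusion. -/
lemma sum_perm_prod_eq (y : ι → ι → R) :
    ∑ σ : Perm ι, ∏ i, y (σ i) i =
      ∑ J : Finset ι, (-1 : R) ^ J.card * ∏ i, ∑ j ∈ Jᶜ, y j i := by
  have h1 : ∀ J : Finset ι, ∏ i, ∑ j ∈ Jᶜ, y j i =
      ∑ h : ι → ι, if J ⊆ (univ.image h)ᶜ then ∏ i, y (h i) i else 0 := by
    intro J
    rw [Finset.prod_univ_sum, ← sum_filter]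
    refine sum_congr ?_ fun _ _ => rfl
    ext h
    simp only [Fintype.mem_piFinset, mem_compl, mem_filter, mem_univ, true_and, subset_iff,
      mem_image, not_exists]
    exact ⟨fun H j hj i hi => H i (hi ▸ hj), fun H i hi => H hi i rfl⟩
  have h2 : ∀ h : ι → ι, ∑ J : Finset ι, (-1 : R) ^ J.card *
      (if J ⊆ (univ.image h)ᶜ then ∏ i, y (h i) i else 0) =
      if Function.Bijective h then ∏ i, y (h i) i else 0 := by
    intro h
    have h3 := congrArg (Int.cast : ℤ → R)
      (sum_powerset_neg_one_pow_card (x := (univ.image h)ᶜ))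
    push_cast at h3
    simp only [mul_ite, mul_zero]
    rw [← sum_filter, filter_subset_univ, ← sum_mul, h3]
    have h4 : (univ.image h)ᶜ = ∅ ↔ Function.Bijective h := by
      rw [compl_eq_empty_iff, ← Finite.surjective_iff_bijective, ← Finset.coe_eq_univ]
      simp [Set.range_eq_univ]
    simp only [h4]
    split_ifs <;> simp
  simp_rw [h1, mul_sum]
  rw [sum_comm]
  simp_rw [h2]
  rw [← sum_filter]
  refine sum_bij (fun σ _ => σ) (fun σ _ => by simp)
    (fun _ _ _ _ h => Equiv.ext (congrFun h)) (fun h hh => ?_) (fun _ _ => rfl)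
  exact ⟨Equiv.ofBijective h (by simpa using hh), mem_univ _, rfl⟩

/-- Polarization: commuting with tensor powers of single matrices implies commuting with all
symmetrized products. -/
lemma sum_perm_kroneckerFamily (x : ι → Matrix κ κ R) :
    ∑ σ : Perm ι, kroneckerFamily (fun i => x (σ i)) =
      ∑ J : Finset ι, (-1 : R) ^ J.card • kroneckerFamily fun _ : ι => ∑ j ∈ Jᶜ, x j := by
  ext f g
  simp only [Matrix.sum_apply, Matrix.smul_apply, smul_eq_mul, kroneckerFamily_apply]
  exact sum_perm_prod_eq fun j i => x j (f i) (g i)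

/-- If a matrix commutes with the tensor powers of the invertible matrices, then it commutes with
all tensor powers. -/
lemma commute_kroneckerFamily_of_isUnit (M : Matrix (ι → κ) (ι → κ) ℚ)
    (h : ∀ g : Matrix κ κ ℚ, IsUnit g.det → Commute M (kroneckerFamily fun _ : ι => g))
    (g : Matrix κ κ ℚ) : Commute M (kroneckerFamily fun _ : ι => g) := by
  -- The commutator with the tensor power of `X - g` has polynomial entries, which vanish at every
  -- `c` that is not an eigenvalue of `g`, hence identically; `X = 0` then gives the claim for `-g`.
  let gX : Matrix κ κ (Polynomial ℚ) := Matrix.scalar κ Polynomial.X - g.map Polynomial.C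
  let MX := M.map Polynomial.C
  have hev : ∀ (c : ℚ) f k, (((MX * kroneckerFamily fun _ : ι => gX) -
      (kroneckerFamily fun _ : ι => gX) * MX) f k).eval c =
      ((M * kroneckerFamily fun _ : ι => (Matrix.scalar κ c - g)) -
      (kroneckerFamily fun _ : ι => (Matrix.scalar κ c - g)) * M) f k := by
    intro c f k
    have : ∀ a b, (gX a b).eval c = (Matrix.scalar κ c - g) a b := by
      intro a b
      simp only [gX, Matrix.sub_apply, Matrix.scalar_apply, Matrix.diagonal_apply, Matrix.map_apply]
      split_ifs <;> simp
    simp only [Matrix.sub_apply, Matrix.mul_apply, Polynomial.eval_sub, Polynomial.eval_finsetSum,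
      Polynomial.eval_mul, kroneckerFamily_apply, Polynomial.eval_prod, this, MX, Matrix.map_apply,
      Polynomial.eval_C]
  have hzero : ∀ f k, ((MX * kroneckerFamily fun _ : ι => gX) -
      (kroneckerFamily fun _ : ι => gX) * MX) f k = 0 := by
    intro f k
    refine Polynomial.eq_zero_of_infinite_isRoot _ ?_
    have hfin : {c : ℚ | g.charpoly.IsRoot c}.Finite :=
      Polynomial.finite_setOfPred_isRoot (Matrix.charpoly_monic g).ne_zero
    refine hfin.infinite_compl.mono fun c hc => ?_
    simp only [Set.mem_compl_iff, Set.mem_ofPred_eq, Polynomial.IsRoot, Matrix.eval_charpoly] at hc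
    simp only [Set.mem_ofPred_eq, Polynomial.IsRoot, hev]
    rw [(h _ (isUnit_iff_ne_zero.2 hc)).eq, sub_self]
    rfl
  have h0 : Commute M (kroneckerFamily fun _ : ι => -g) := by
    refine sub_eq_zero.1 (Matrix.ext fun f k => ?_)
    have := hev 0 f k
    rw [hzero] at this
    simpa using this.symm
  have h1 : (kroneckerFamily fun _ : ι => g) =
      (-1 : ℚ) ^ (Fintype.card ι) • kroneckerFamily fun _ : ι => -g := by
    ext f k
    simp only [kroneckerFamily_apply, Matrix.smul_apply, Matrix.neg_apply, prod_neg, smul_eq_mul,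
      ← mul_assoc, ← mul_pow, card_univ]
    simp
  rw [h1]
  exact h0.smul_right _

/-- A matrix on the tensor power that is invariant under the permutations of the factors is a
combination of symmetrized Kronecker products. -/
lemma card_smul_eq_sum_kroneckerFamily (Φ : Matrix (ι → κ) (ι → κ) R)
    (hΦ : ∀ (σ : Perm ι) f g, Φ (f ∘ σ) (g ∘ σ) = Φ f g) :
    (Fintype.card (Perm ι) : R) • Φ = ∑ f : ι → κ, ∑ g : ι → κ, Φ f g •
      ∑ σ : Perm ι, kroneckerFamily fun i => Matrix.single (f (σ i)) (g (σ i)) (1 : R) := by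
  have h1 : ∀ (f g a b : ι → κ) (σ : Perm ι),
      kroneckerFamily (fun i => Matrix.single (f (σ i)) (g (σ i)) (1 : R)) a b =
        if f = a ∘ σ.symm ∧ g = b ∘ σ.symm then 1 else 0 := by
    intro f g a b σ
    simp only [kroneckerFamily_apply, Matrix.single_apply]
    rw [Finset.prod_ite_zero]
    simp only [Equiv.eq_comp_symm]
    simp only [funext_iff, Function.comp_apply, mem_univ, true_implies,
      ← forall_and, prod_const_one]
  ext a b
  simp only [Matrix.smul_apply, Matrix.sum_apply, h1, smul_eq_mul, mul_sum]
  have h2 : ∀ σ : Perm ι, ∑ f : ι → κ, ∑ g : ι → κ,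
      Φ f g * (if f = a ∘ σ.symm ∧ g = b ∘ σ.symm then 1 else 0) = Φ a b := by
    intro σ
    rw [sum_eq_single (a ∘ σ.symm) (fun f _ hf => by simp [hf]) (by simp),
      sum_eq_single (b ∘ σ.symm) (fun f _ hf => by simp [hf]) (by simp)]
    simpa using hΦ σ.symm a b
  have h3 : ∑ f : ι → κ, ∑ g : ι → κ, ∑ σ : Perm ι,
      Φ f g * (if f = a ∘ σ.symm ∧ g = b ∘ σ.symm then 1 else 0) =
      ∑ σ : Perm ι, ∑ f : ι → κ, ∑ g : ι → κ,
      Φ f g * (if f = a ∘ σ.symm ∧ g = b ∘ σ.symm then 1 else 0) := by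
    rw [sum_comm]
    rw [sum_comm]
    simp_rw [sum_comm (s := (univ : Finset (ι → κ))) (t := (univ : Finset (Perm ι)))]
  rw [h3]
  simp only [h2, sum_const, card_univ, nsmul_eq_mul]

/-- The permutation representation on the tensor power. -/
def tensorRep (ι κ : Type*) : Representation ℚ (Perm ι) ((ι → κ) → ℚ) where
  toFun σ := LinearMap.funLeft ℚ ℚ fun f : ι → κ => f ∘ σ
  map_one' := rfl
  map_mul' _ _ := rfl

lemma tensorRep_apply (σ : Perm ι) (v : (ι → κ) → ℚ) (f : ι → κ) :
    tensorRep ι κ σ v f = v (f ∘ σ) := rfl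

/-- The first fundamental theorem for matrix invariants: a matrix on the tensor power that commutes
with the tensor powers of invertible matrices is a combination of permutations of the factors. -/
theorem exists_perm_coeff (M : Matrix (ι → κ) (ι → κ) ℚ)
    (h : ∀ g : Matrix κ κ ℚ, IsUnit g.det → Commute M (kroneckerFamily fun _ : ι => g)) :
    ∃ w : Perm ι → ℚ, ∀ f g, M f g = ∑ s, w s * if f ∘ s = g then 1 else 0 := by
  have hsym : ∀ x : ι → Matrix κ κ ℚ,
      Commute M (∑ σ : Perm ι, kroneckerFamily fun i => x (σ i)) := by
    intro x
    rw [sum_perm_kroneckerFamily]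
    exact Commute.sum_right _ _ _ fun J _ =>
      (commute_kroneckerFamily_of_isUnit M h _).smul_right _
  have hcomm : ∀ Φ : Matrix (ι → κ) (ι → κ) ℚ,
      (∀ (σ : Perm ι) f g, Φ (f ∘ σ) (g ∘ σ) = Φ f g) → Commute M Φ := by
    intro Φ hΦ
    have h1 : Commute M ((Fintype.card (Perm ι) : ℚ) • Φ) := by
      rw [card_smul_eq_sum_kroneckerFamily Φ hΦ]
      refine Commute.sum_right _ _ _ fun f _ => Commute.sum_right _ _ _ fun g _ =>
        Commute.smul_right ?_ _
      exact hsym fun i => Matrix.single (f i) (g i) 1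
    have h2 := h1.smul_right ((Fintype.card (Perm ι) : ℚ)⁻¹)
    rwa [inv_smul_smul₀ (by exact_mod_cast Fintype.card_ne_zero)] at h2
  -- An endomorphism that commutes with the permutations of the factors has a permutation invariant
  -- matrix, with which `M` commutes by `hcomm`; so `M` lies in the double centralizer of the
  -- permutations.
  obtain ⟨r, hr⟩ := exists_asAlgebraHom_eq (tensorRep ι κ) (Matrix.toLin' M) (by
    intro φ hφ v
    have h1 : Commute M (LinearMap.toMatrix' φ) := by
      refine hcomm _ fun σ f g => ?_
      have h2 := congrFun (hφ σ (Pi.single (g ∘ σ) 1)) f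
      simp only [tensorRep_apply] at h2
      rw [LinearMap.toMatrix'_apply, LinearMap.toMatrix'_apply]
      refine h2.symm.trans (congrFun (congrArg φ (funext fun k => ?_)) f)
      simp only [tensorRep_apply, Pi.single_apply]
      congr 1
      exact propext σ.surjective.right_cancellable
    have h3 := congrArg (fun N => Matrix.toLin' N v) h1.eq
    simpa [Matrix.toLin'_mul] using h3)
  refine ⟨fun s => r.coeff s, fun f g => ?_⟩
  have h1 := congrFun (congrFun (congrArg DFunLike.coe hr) (Pi.single g 1)) f
  rw [Matrix.toLin'_apply, Matrix.mulVec_single_one] at h1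
  rw [show M f g = M.col g f from rfl, h1, Representation.asAlgebraHom_def,
    MonoidAlgebra.lift_apply, Finsupp.sum_fintype _ _ (by simp)]
  simp only [LinearMap.sum_apply, LinearMap.smul_apply, Finset.sum_apply, Pi.smul_apply,
    tensorRep_apply, smul_eq_mul, Pi.single_apply]

end TensorPower

/-! ### The alternating tensor of the matrix units -/

section AlternatingTensor

variable {κ R : Type*} [Fintype κ] [DecidableEq κ] [CommRing R]

/-- The matrix of coordinates of a family of matrices in the basis of matrix units. -/
def coordMatrix {ι : Type*} (x : ι → Matrix κ κ R) : Matrix ι (κ × κ) R :=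
  Matrix.of fun j p => x j p.1 p.2

/-- The matrix units. -/
def matrixUnit (R : Type*) [CommRing R] {κ : Type*} [DecidableEq κ] (p : κ × κ) : Matrix κ κ R :=
  Matrix.single p.1 p.2 1

/-- The alternating sum of the Kronecker products of all arrangements of the matrix units. -/
def altTensor (R : Type*) [CommRing R] {κ : Type*} [Fintype κ] [DecidableEq κ] :
    Matrix (κ × κ → κ) (κ × κ → κ) R :=
  Matrix.of fun f g => (Matrix.of fun p i : κ × κ => if p = (f i, g i) then (1 : R) else 0).det

/-- The left side is the determinant of `coordMatrix x` times the 0-1 matrix whose column `i` is the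
unit vector at `(f i, g i)`. -/
lemma sum_sign_prod_eq (x : κ × κ → Matrix κ κ R) (f g : κ × κ → κ) :
    ∑ σ : Perm (κ × κ), ((Perm.sign σ : ℤ) : R) * ∏ i, x (σ i) (f i) (g i) =
      (coordMatrix x).det * altTensor R f g := by
  simp only [altTensor, Matrix.of_apply]
  rw [← Matrix.det_mul, Matrix.det_apply']
  simp [Matrix.mul_apply, coordMatrix]

lemma coordMatrix_matrixUnit : coordMatrix (matrixUnit R (κ := κ)) = 1 := by
  ext i p
  simp only [coordMatrix, matrixUnit, Matrix.of_apply, Matrix.single_apply, Matrix.one_apply,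
    Prod.ext_iff]

lemma sum_sign_kroneckerFamily (x : κ × κ → Matrix κ κ R) :
    ∑ σ : Perm (κ × κ), ((Perm.sign σ : ℤ) : R) • kroneckerFamily (fun i => x (σ i)) =
      (coordMatrix x).det • altTensor R := by
  ext f g
  simp only [Matrix.sum_apply, Matrix.smul_apply, kroneckerFamily_apply, smul_eq_mul,
    sum_sign_prod_eq]

lemma altTensor_eq : altTensor R (κ := κ) = ∑ σ : Perm (κ × κ), ((Perm.sign σ : ℤ) : R) •
    kroneckerFamily (fun i => matrixUnit R (σ i)) := by
  rw [sum_sign_kroneckerFamily, coordMatrix_matrixUnit, Matrix.det_one, one_smul]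

lemma coordMatrix_matrixUnit_mul (g : Matrix κ κ R) :
    coordMatrix (fun i => matrixUnit R i * g) = Matrix.kroneckerMap (· * ·) 1 g := by
  ext i p
  simp only [coordMatrix, matrixUnit, Matrix.of_apply, Matrix.kroneckerMap_apply, Matrix.mul_apply,
    Matrix.single_apply, Matrix.one_apply]
  rw [sum_eq_single i.2 (fun b _ hb => by simp [hb.symm]) (by simp)]
  simp

lemma coordMatrix_mul_matrixUnit (g : Matrix κ κ R) :
    coordMatrix (fun i => g * matrixUnit R i) = Matrix.kroneckerMap (· * ·) g.transpose 1 := by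
  ext i p
  simp only [coordMatrix, matrixUnit, Matrix.of_apply, Matrix.kroneckerMap_apply, Matrix.mul_apply,
    Matrix.single_apply, Matrix.one_apply, Matrix.transpose_apply]
  rw [sum_eq_single i.1 (fun b _ hb => by simp [hb.symm]) (by simp)]
  simp

/-- Multiplying all matrix units by `g` on one side changes the basis of the matrix space, with
determinant `det g ^ n` (`n = |κ|`) on either side; the alternating tensor is scaled by this factor
both times. -/
lemma altTensor_commute (g : Matrix κ κ R) :
    Commute (altTensor R) (kroneckerFamily fun _ : κ × κ => g) := by
  have h1 : altTensor R * (kroneckerFamily fun _ : κ × κ => g) =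
      (Matrix.kroneckerMap (· * ·) (1 : Matrix κ κ R) g).det • altTensor R := by
    rw [← coordMatrix_matrixUnit_mul, ← sum_sign_kroneckerFamily, altTensor_eq, sum_mul]
    simp only [smul_mul_assoc, kroneckerFamily_mul]
  have h2 : (kroneckerFamily fun _ : κ × κ => g) * altTensor R =
      (Matrix.kroneckerMap (· * ·) g.transpose (1 : Matrix κ κ R)).det • altTensor R := by
    rw [← coordMatrix_mul_matrixUnit, ← sum_sign_kroneckerFamily, altTensor_eq, mul_sum]
    simp only [mul_smul_comm, kroneckerFamily_mul]
  rw [Commute, SemiconjBy, h1, h2, Matrix.det_kronecker, Matrix.det_kronecker]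
  simp

lemma altTensor_comp (f g : κ × κ → κ) (τ : Perm (κ × κ)) :
    altTensor R (f ∘ τ) (g ∘ τ) = ((Perm.sign τ : ℤ) : R) * altTensor R f g := by
  simp only [altTensor, Matrix.of_apply]
  rw [← Matrix.det_permute']
  rfl

lemma altTensor_fst_snd : altTensor R (Prod.fst : κ × κ → κ) Prod.snd = 1 := by
  simp only [altTensor, Matrix.of_apply, Prod.mk.eta]
  exact (congrArg Matrix.det (by ext i j; simp [Matrix.one_apply])).trans Matrix.det_one

/-- The trace of the alternating tensor against a permutation of the factors: the alternating sum
of the corresponding product of traces of products of matrix units. -/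
def altTrace (κ : Type*) [Fintype κ] [DecidableEq κ] (π : Perm (κ × κ)) : ℚ :=
  ∑ f : κ × κ → κ, altTensor ℚ f (f ∘ π)

/-- With `altTensor` written as a combination of permutations, the sum of the squares of its entries
is a combination of the numbers `altTrace κ s`. Over `ℚ` it is positive, since one entry is `1`. -/
lemma exists_altTrace_ne_zero : ∃ π : Perm (κ × κ), altTrace κ π ≠ 0 := by
  by_contra! h
  obtain ⟨w, hw⟩ := exists_perm_coeff (altTensor ℚ (κ := κ)) fun g _ => altTensor_commute g
  have h1 : ∑ f : κ × κ → κ, ∑ g : κ × κ → κ, altTensor ℚ f g * altTensor ℚ f g = 0 := by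
    have h2 : ∀ f g : κ × κ → κ, altTensor ℚ f g * altTensor ℚ f g =
        ∑ s, w s * if f ∘ s = g then altTensor ℚ f g else 0 := by
      intro f g
      conv_lhs => rw [hw f g, sum_mul]
      refine sum_congr rfl fun s _ => ?_
      rw [← hw]; split_ifs <;> ring
    have h3 : ∀ f : κ × κ → κ, ∑ g : κ × κ → κ, altTensor ℚ f g * altTensor ℚ f g =
        ∑ s, w s * altTensor ℚ f (f ∘ s) := by
      intro f
      simp_rw [h2]
      rw [sum_comm]
      simp
    simp_rw [h3]
    rw [sum_comm]
    simp_rw [← mul_sum]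
    exact sum_eq_zero fun s _ => by rw [show ∑ f, altTensor ℚ f (f ∘ s) = 0 from h s, mul_zero]
  have h4 := (sum_eq_zero_iff_of_nonneg fun f _ => sum_nonneg fun g _ => mul_self_nonneg _).1 h1
    Prod.fst (mem_univ _)
  have h5 := (sum_eq_zero_iff_of_nonneg fun g _ => mul_self_nonneg _).1 h4 Prod.snd (mem_univ _)
  rw [altTensor_fst_snd] at h5
  norm_num at h5

/-- Relabelling the positions by `τ` in the centralizer multiplies `altTrace κ π` by the sign of
`τ`. -/
lemma centralizer_le_of_altTrace_ne_zero {π : Perm (κ × κ)} (h : altTrace κ π ≠ 0) :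
    Subgroup.centralizer {π} ≤ alternatingGroup (κ × κ) := by
  intro τ hτ
  rw [Subgroup.mem_centralizer_singleton_iff] at hτ
  have h1 : altTrace κ π = ((Perm.sign τ : ℤ) : ℚ) * altTrace κ π := by
    conv_lhs => rw [altTrace, ← (Equiv.arrowCongr τ.symm (Equiv.refl κ)).sum_comp]
    rw [altTrace, mul_sum]
    refine sum_congr rfl fun f _ => ?_
    rw [← altTensor_comp]
    congr 1
    ext i
    have := congrArg (fun ρ : Perm (κ × κ) => f (ρ i)) hτ
    simpa using this
  rw [Perm.mem_alternatingGroup]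
  rcases Int.units_eq_one_or (Perm.sign τ) with h2 | h2
  · exact h2
  · rw [h2] at h1
    exact absurd (by push_cast at h1; linarith) h

end AlternatingTensor

/-! ### Counting cycles of distinct odd lengths -/

section CycleCount

/-- The smallest sum of `r` distinct odd numbers is `1 + 3 + ⋯ + (2r - 1) = r²`. -/
lemma card_sq_le_sum (S : Finset ℕ) : S.card ^ 2 ≤ ∑ j ∈ S, (2 * j + 1) := by
  induction S using Finset.induction_on_max with
  | empty => simp
  | insert a s ha ih =>
    have h1 : a ∉ s := fun h => (ha a h).false
    have h2 : s.card ≤ a := by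
      simpa using card_le_card (show s ⊆ range a from fun x hx => mem_range.2 (ha x hx))
    rw [sum_insert h1, card_insert_of_notMem h1]
    nlinarith

/-- The number of cycles (including fixed points) of a permutation whose centralizer consists of
even permutations is at most the square root of the number of points: the cycles have distinct odd
lengths. -/
lemma card_quotient_sameCycle_sq_le {α : Type*} [Fintype α] [DecidableEq α] {π : Perm α}
    (h : Subgroup.centralizer {π} ≤ alternatingGroup α) :
    Nat.card (Quotient (Perm.SameCycle.setoid π)) ^ 2 ≤ Fintype.card α := by
  classical
  -- Nontrivial cycles have odd length, at most one point is fixed, and no nontrivial length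
  -- repeats. As `cycleType` omits fixed points, these are treated separately below.
  obtain ⟨hodd, hfix, hcount⟩ := Perm.centralizer_le_alternating_iff.1 h
  let Q := Quotient (Perm.SameCycle.setoid π)
  let sz : Q → ℕ := fun q => (univ.filter fun y : α => (Quotient.mk _ y : Q) = q).card
  have hmk : ∀ (q : Q) y, (Quotient.mk _ y : Q) = q ↔ π.SameCycle q.out y := by
    intro q y
    conv_lhs => rw [← q.out_eq]
    rw [Quotient.eq]
    exact ⟨fun h => Perm.SameCycle.symm h, fun h => Perm.SameCycle.symm h⟩
  have hsum : ∑ q, sz q = Fintype.card α := by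
    rw [← card_univ, card_eq_sum_card_fiberwise (f := fun y : α => (Quotient.mk _ y : Q))
      (t := univ) (by simp)]
  have hfixed : ∀ q : Q, π q.out = q.out → sz q = 1 := by
    intro q hq
    rw [card_eq_one]
    refine ⟨q.out, ?_⟩
    ext y
    simp only [mem_filter, mem_univ, true_and, hmk, mem_singleton]
    constructor
    · intro hy; exact (Perm.SameCycle.eq_of_left hy hq).symm
    · rintro rfl; exact Perm.SameCycle.refl _ _
  have hmoved : ∀ q : Q, π q.out ≠ q.out → sz q = (π.cycleOf q.out).support.card := by
    intro q hq
    refine congrArg Finset.card ?_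
    ext y
    simp only [mem_filter, mem_univ, true_and, hmk, Perm.mem_support_cycleOf_iff]
    rw [Perm.mem_support]
    exact ⟨fun hy => ⟨hy, hq⟩, fun hy => hy.1⟩
  have hmem : ∀ q : Q, π q.out ≠ q.out → π.cycleOf q.out ∈ π.cycleFactorsFinset := fun q hq =>
    Perm.cycleOf_mem_cycleFactorsFinset_iff.2 (Perm.mem_support.2 hq)
  have htype : ∀ q : Q, π q.out ≠ q.out → sz q ∈ π.cycleType := by
    intro q hq
    rw [hmoved q hq, Perm.cycleType_def]
    exact Multiset.mem_map_of_mem _ (hmem q hq)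
  have hszodd : ∀ q, Odd (sz q) := by
    intro q
    by_cases hq : π q.out = q.out
    · rw [hfixed q hq]; exact odd_one
    · exact hodd _ (htype q hq)
  have hinj : Function.Injective sz := by
    intro q q' hqq
    by_contra hne
    have hnc : ¬ π.SameCycle q.out q'.out := by
      intro hc
      exact hne (by rw [← (hmk q q'.out).2 hc, Quotient.out_eq])
    have hne' : q.out ≠ q'.out := fun h => hnc (h ▸ Perm.SameCycle.refl _ _)
    by_cases hq : π q.out = q.out <;> by_cases hq' : π q'.out = q'.out
    · rw [Perm.sum_cycleType] at hfix
      have h1 : ({q.out, q'.out} : Finset α) ⊆ π.supportᶜ := by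
        intro x hx
        simp only [mem_insert, mem_singleton] at hx
        rcases hx with rfl | rfl <;> simpa
      have h2 := card_le_card h1
      rw [card_pair hne', card_compl] at h2
      omega
    · have := Perm.two_le_of_mem_cycleType (htype q' hq')
      rw [← hqq, hfixed q hq] at this
      omega
    · have := Perm.two_le_of_mem_cycleType (htype q hq)
      rw [hqq, hfixed q' hq'] at this
      omega
    · have h1 := hcount (sz q)
      rw [Perm.cycleType_def, Multiset.count_map] at h1
      have h2 : ({π.cycleOf q.out, π.cycleOf q'.out} : Finset (Perm α)).card ≤
          (Multiset.filter (fun c => sz q = (Finset.card ∘ Perm.support) c)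
            π.cycleFactorsFinset.val).card := by
        refine card_le_card (t := π.cycleFactorsFinset.filter
          (fun c => sz q = (Finset.card ∘ Perm.support) c)) ?_
        intro c hc
        simp only [mem_insert, mem_singleton] at hc
        rcases hc with rfl | rfl
        · exact mem_filter.2 ⟨hmem q hq, hmoved q hq⟩
        · exact mem_filter.2 ⟨hmem q' hq', hqq.trans (hmoved q' hq')⟩
      rw [card_pair] at h2
      · omega
      · intro heq
        have h3 : q'.out ∈ (π.cycleOf q'.out).support := by
          rw [Perm.mem_support_cycleOf_iff]
          exact ⟨Perm.SameCycle.refl _ _, Perm.mem_support.2 hq'⟩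
        rw [← heq, Perm.mem_support_cycleOf_iff] at h3
        exact hnc h3.1
  have h1 := card_sq_le_sum (univ.image fun q => sz q / 2)
  have hhalf : ∀ q, 2 * (sz q / 2) + 1 = sz q := fun q => Nat.two_mul_div_two_add_one_of_odd (hszodd q)
  have hinj2 : Function.Injective fun q => sz q / 2 := by
    intro q q' hqq
    apply hinj
    rw [← hhalf q, ← hhalf q']
    simp only at hqq
    rw [hqq]
  rw [card_image_of_injective _ hinj2, sum_image fun _ _ _ _ h => hinj2 h] at h1
  simp only [hhalf, hsum, card_univ] at h1
  rwa [Nat.card_eq_fintype_card]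

end CycleCount

/-! ### Merging cycles; permutations with a single cycle -/

section MergeCycles

/-- If `s` moves at most one point of each cycle of `π`, then every function invariant under
`π * s` is invariant under `π`. -/
lemma apply_eq_of_apply_mul_eq {α β : Type*} [Finite α] (π s : Perm α)
    (hs : ∀ x y, π.SameCycle x y → s x ≠ x → s y ≠ y → x = y) (f : α → β)
    (h : ∀ x, f (π (s x)) = f x) (x : α) : f (π x) = f x := by
  by_cases hx : s x = x
  · simpa [hx] using h x
  have hper : x ∈ Function.periodicPts π :=
    (Function.Injective.mem_periodicPts π.injective x)
  -- Along the orbit from `π x` until the return to `x`, every point lies in the cycle of the moved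
  -- point `x`, so `s` fixes it and the hypothesis on `f` passes to the next point.
  have key : ∀ j, 1 ≤ j → j ≤ Function.minimalPeriod π x → f (π^[j] x) = f (π x) := by
    intro j hj
    induction j, hj using Nat.le_induction with
    | base => intro _; rfl
    | succ j hj ih =>
      intro hj'
      rw [Function.iterate_succ_apply', ← ih (by omega)]
      have hne : π^[j] x ≠ x :=
        Function.not_isPeriodicPt_of_pos_of_lt_minimalPeriod (by omega) (by omega)
      have hfix : s (π^[j] x) = π^[j] x := by
        by_contra hmv
        exact hne (hs _ _ ⟨j, by simp [Perm.iterate_eq_pow]⟩ hx hmv).symm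
      simpa [hfix] using h (π^[j] x)
  have h1 := key _ (Function.minimalPeriod_pos_of_mem_periodicPts hper) le_rfl
  rw [Function.iterate_minimalPeriod] at h1
  exact h1.symm

/-- `w` is a single cycle through all points: functions invariant under `w` are constant. -/
def IsFullCycle {α : Type*} (w : Perm α) : Prop :=
  ∀ f : α → Prop, (∀ x, f (w x) = f x) → ∀ x y, f x = f y

lemma isFullCycle_finRotate (m : ℕ) : IsFullCycle (finRotate (m + 1)) := by
  intro f hf
  have : ∀ i, f i = f 0 := by
    intro i
    induction i using Fin.induction with
    | zero => rfl
    | succ i ih => rw [← ih, ← hf i.castSucc, finRotate_apply, Fin.coeSucc_eq_succ]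
  intro x y; rw [this x, this y]

lemma exists_isFullCycle (α : Type*) [Fintype α] [Nonempty α] : ∃ ρ : Perm α, IsFullCycle ρ := by
  obtain ⟨m, hm⟩ := Nat.exists_eq_succ_of_ne_zero (Fintype.card_ne_zero (α := α))
  let e : α ≃ Fin (m + 1) := Fintype.equivFinOfCardEq hm
  refine ⟨e.symm.permCongr (finRotate (m + 1)), fun f hf x y => ?_⟩
  have := isFullCycle_finRotate m (f ∘ e.symm) (fun i => by simpa using hf (e.symm i)) (e x) (e y)
  simpa using this

end MergeCycles

/-! ### Nonvanishing of the Weingarten function -/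

section WeingartenCoeff

lemma numInvariant_permCongr {κ α β : Type*} [Fintype κ] [DecidableEq κ] [Fintype α]
    [DecidableEq α] [Fintype β] [DecidableEq β] (e : α ≃ β) (σ : Perm α) :
    numInvariant κ (e.permCongr σ) = numInvariant κ σ := by
  unfold numInvariant
  refine card_bij' (fun a _ => a ∘ e) (fun a _ => a ∘ e.symm) ?_ ?_ ?_ ?_
  · intro a ha
    simp only [mem_filter, mem_univ, true_and, funext_iff, Function.comp_apply] at ha ⊢
    intro x; simpa using ha (e x)
  · intro a ha
    simp only [mem_filter, mem_univ, true_and, funext_iff, Function.comp_apply] at ha ⊢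
    intro x; simpa using ha (e.symm x)
  · intro a _; ext x; simp
  · intro a _; ext x; simp

/-- The Weingarten function of `n × n` matrices on the permutations of at most `n` points has no
zeros. -/
theorem weingarten_ne_zero {α : Type*} [Fintype α] [DecidableEq α] {n : ℕ}
    (hα : Fintype.card α ≤ n) (w : Perm α → ℚ) {c : ℚ} (hc : c ≠ 0)
    (h : ∀ ρ, ∑ g, w (g * ρ) * numInvariant (Fin n) g = if ρ = 1 then c else 0) (s : Perm α) :
    w s ≠ 0 := by
  let e := Fintype.equivFin α
  -- Twisting by the sign and inverting the argument turns the hypothesis into `signedConv n v =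
  -- δ₁`, to which `pos_of_signedConv` applies.
  let v : Perm (Fin (Fintype.card α)) → ℚ := fun σ =>
    c⁻¹ * (Perm.sign σ : ℤ) * w (e.permCongr.symm σ⁻¹)
  have hs : ∀ g : Perm (Fin (Fintype.card α)), ((Perm.sign g : ℤ) : ℚ) * (Perm.sign g : ℤ) = 1 := by
    intro g
    rcases Int.units_eq_one_or (Perm.sign g) with h | h <;> simp [h]
  have hv : ∀ π, signedConv n v π = if π = 1 then 1 else 0 := by
    intro π
    have h1 := h (e.permCongr.symm π⁻¹)
    have h2 : signedConv n v π = c⁻¹ * (Perm.sign π : ℤ) *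
        ∑ g, w (g * e.permCongr.symm π⁻¹) * numInvariant (Fin n) g := by
      rw [signedConv, ← e.permCongr.sum_comp, mul_sum]
      refine sum_congr rfl fun g _ => ?_
      rw [numInvariant_permCongr]
      have h3 : (π * (e.permCongr g)⁻¹)⁻¹ = e.permCongr g * π⁻¹ := by group
      have h4 : e.permCongr.symm (e.permCongr g * π⁻¹) = g * e.permCongr.symm π⁻¹ := by
        ext x; simp [Perm.mul_apply]
      simp only [v, h3, h4, Perm.sign_mul, Perm.sign_inv]
      push_cast
      linear_combination (c⁻¹ * (Perm.sign π : ℤ) * w (g * e.permCongr.symm π⁻¹) *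
        numInvariant (Fin n) g) * hs (e.permCongr g)
    rw [h2, h1]
    by_cases hπ : π = 1
    · subst hπ
      have : e.permCongr.symm (1 : Perm (Fin (Fintype.card α)))⁻¹ = 1 := by ext x; simp
      rw [if_pos this]; simp [hc]
    · have : e.permCongr.symm π⁻¹ ≠ 1 := by
        intro h5
        apply hπ
        rw [Equiv.symm_apply_eq] at h5
        rw [← inv_eq_one, h5]
        ext x; simp
      rw [if_neg this, if_neg hπ, mul_zero]
  have hpos := (pos_of_signedConv hα v fun π => by rw [hv]; split_ifs <;> norm_num).2
    ⟨1, by simp [hv]⟩ (e.permCongr s)⁻¹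
  intro h0
  have h1 : e.permCongr.symm (e.permCongr s)⁻¹⁻¹ = s := by simp only [inv_inv, symm_apply_apply]
  simp only [v, h1, h0, mul_zero, lt_irrefl] at hpos

end WeingartenCoeff

/-! ### Partial traces -/

section PartialTrace

variable {S T R : Type*} [Fintype S] [DecidableEq S] [Fintype T] [DecidableEq T] [CommRing R]

/-- The partial trace over the second factor. -/
def partialTrace (M : Matrix (S × T) (S × T) R) : Matrix S S R :=
  Matrix.of fun a b => ∑ c, M (a, c) (b, c)

open Matrix in
-- Write `A ⊗ 1 = (A ⊗ B)(1 ⊗ B')`. The partial trace is linear over matrices on the first factor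
-- and cyclic for matrices on the second, so `B` and `B'` cancel.
lemma partialTrace_commute (M : Matrix (S × T) (S × T) R) (A : Matrix S S R) (B B' : Matrix T T R)
    (hB : B' * B = 1) (h : Commute M (kroneckerMap (· * ·) A B)) :
    Commute (partialTrace M) A := by
  have h1 : ∀ N : Matrix (S × T) (S × T) R,
      partialTrace (N * kroneckerMap (· * ·) A (1 : Matrix T T R)) = partialTrace N * A := by
    intro N
    ext a b
    simp only [partialTrace, of_apply, mul_apply, kroneckerMap_apply, Fintype.sum_prod_type,
      one_apply, sum_mul]
    rw [sum_comm]
    refine sum_congr rfl fun x _ => sum_congr rfl fun y _ => ?_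
    simp
  have h2 : ∀ N : Matrix (S × T) (S × T) R,
      partialTrace (kroneckerMap (· * ·) A (1 : Matrix T T R) * N) = A * partialTrace N := by
    intro N
    ext a b
    simp only [partialTrace, of_apply, mul_apply, kroneckerMap_apply, Fintype.sum_prod_type,
      one_apply, mul_sum]
    rw [sum_comm]
    refine sum_congr rfl fun x _ => sum_congr rfl fun y _ => ?_
    simp
  have h3 : ∀ (N : Matrix (S × T) (S × T) R) (C : Matrix T T R),
      partialTrace (kroneckerMap (· * ·) (1 : Matrix S S R) C * N) =
        partialTrace (N * kroneckerMap (· * ·) (1 : Matrix S S R) C) := by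
    intro N C
    ext a b
    simp only [partialTrace, of_apply, mul_apply, kroneckerMap_apply, Fintype.sum_prod_type,
      one_apply]
    simp only [ite_mul, one_mul, zero_mul, mul_ite, mul_zero]
    have e1 : ∀ x : T, ∑ x_1 : S, ∑ x_2 : T, (if a = x_1 then C x x_2 * N (x_1, x_2) (b, x) else 0)
        = ∑ x_2 : T, C x x_2 * N (a, x_2) (b, x) := by
      intro x
      rw [sum_eq_single a (fun y _ hy => by simp [hy.symm]) (by simp)]
      simp
    have e2 : ∀ x : T, ∑ x_1 : S, ∑ x_2 : T, (if x_1 = b then N (a, x) (x_1, x_2) * C x_2 x else 0)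
        = ∑ x_2 : T, N (a, x) (b, x_2) * C x_2 x := by
      intro x
      rw [sum_eq_single b (fun y _ hy => by simp [hy]) (by simp)]
      simp
    simp_rw [e1, e2]
    rw [sum_comm]
    simp_rw [mul_comm]
  have h4 : kroneckerMap (· * ·) A (1 : Matrix T T R) =
      kroneckerMap (· * ·) A B * kroneckerMap (· * ·) (1 : Matrix S S R) B' := by
    rw [← mul_kronecker_mul, mul_one, mul_eq_one_comm.1 hB]
  have h5 : kroneckerMap (· * ·) A B =
      kroneckerMap (· * ·) A (1 : Matrix T T R) * kroneckerMap (· * ·) (1 : Matrix S S R) B := by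
    rw [← mul_kronecker_mul, mul_one, one_mul]
  rw [Commute, SemiconjBy, ← h1, h4, ← mul_assoc, h.eq, h5, mul_assoc, mul_assoc, h2, h3,
    mul_assoc, ← mul_kronecker_mul, hB, one_mul, one_kronecker_one, mul_one]

end PartialTrace

/-! ### Contraction of the alternating tensor along a permutation -/

section Contraction

variable {κ : Type*} [Fintype κ] [DecidableEq κ]

/-- A function on the points with property `p` and a function on the others, taken together. -/
def glue {ι : Type*} {p : ι → Prop} [DecidablePred p] (a : {x // p x} → κ) (c : {x // ¬ p x} → κ) :
    ι → κ :=
  (Equiv.piEquivPiSubtypeProd p fun _ => κ).symm (a, c)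

lemma glue_of_pos {ι : Type*} {p : ι → Prop} [DecidablePred p] (a : {x // p x} → κ)
    (c : {x // ¬ p x} → κ) {x : ι} (hx : p x) : glue a c x = a ⟨x, hx⟩ := by
  simp [glue, Equiv.piEquivPiSubtypeProd, hx]

lemma glue_of_neg {ι : Type*} {p : ι → Prop} [DecidablePred p] (a : {x // p x} → κ)
    (c : {x // ¬ p x} → κ) {x : ι} (hx : ¬ p x) : glue a c x = c ⟨x, hx⟩ := by
  simp [glue, Equiv.piEquivPiSubtypeProd, hx]

lemma sum_glue {ι : Type*} [Fintype ι] [DecidableEq ι] (p : ι → Prop) [DecidablePred p]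
    (F : (ι → κ) → ℚ) :
    ∑ f, F f = ∑ a : {x // p x} → κ, ∑ c : {x // ¬ p x} → κ, F (glue a c) := by
  rw [← (Equiv.piEquivPiSubtypeProd p fun _ => κ).symm.sum_comp, Fintype.sum_prod_type]
  rfl

/-- The alternating tensor, multiplied by `π` and contracted in the factors without the
property `p`. -/
def contractedTensor (π : Perm (κ × κ)) (p : κ × κ → Prop) [DecidablePred p] :
    Matrix ({x // p x} → κ) ({x // p x} → κ) ℚ :=
  Matrix.of fun a b => ∑ c, altTensor ℚ (glue a c ∘ π.symm) (glue b c)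

/-- The alternating tensor and the permutations of the factors commute with the tensor powers of
`g`; the partial trace preserves this for invertible `g`. -/
lemma contractedTensor_commute (π : Perm (κ × κ)) (p : κ × κ → Prop) [DecidablePred p]
    (g : Matrix κ κ ℚ) (hg : IsUnit g.det) :
    Commute (contractedTensor π p) (kroneckerFamily fun _ => g) := by
  let M : Matrix (({x // p x} → κ) × ({x // ¬ p x} → κ)) (({x // p x} → κ) × ({x // ¬ p x} → κ)) ℚ :=
    Matrix.of fun u v => altTensor ℚ (glue u.1 u.2 ∘ π.symm) (glue v.1 v.2)
  have hM : contractedTensor π p = partialTrace M := rfl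
  rw [hM]
  refine partialTrace_commute M _ (kroneckerFamily fun _ => g) (kroneckerFamily fun _ => g⁻¹) ?_ ?_
  · rw [kroneckerFamily_mul]
    simp only [Matrix.nonsing_inv_mul g hg, kroneckerFamily_one]
  · have hk : ∀ u v : ({x // p x} → κ) × ({x // ¬ p x} → κ),
        Matrix.kroneckerMap (· * ·) (kroneckerFamily fun _ => g) (kroneckerFamily fun _ => g) u v =
          kroneckerFamily (fun _ => g) (glue u.1 u.2) (glue v.1 v.2) := by
      intro u v
      simp only [Matrix.kroneckerMap_apply, kroneckerFamily_apply]
      rw [← Fintype.prod_subtype_mul_prod_subtype p]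
      congr 1
      · exact prod_congr rfl fun i _ => by rw [glue_of_pos _ _ i.2, glue_of_pos _ _ i.2]
      · exact prod_congr rfl fun i _ => by rw [glue_of_neg _ _ i.2, glue_of_neg _ _ i.2]
    ext u v
    simp only [Matrix.mul_apply, hk, M, Matrix.of_apply, Fintype.sum_prod_type]
    rw [← sum_glue p fun k => altTensor ℚ (glue u.1 u.2 ∘ π.symm) k *
      kroneckerFamily (fun _ => g) k (glue v.1 v.2), ← sum_glue p fun k =>
      kroneckerFamily (fun _ => g) (glue u.1 u.2) k * altTensor ℚ (k ∘ π.symm) (glue v.1 v.2)]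
    have h1 := congrFun (congrFun (altTensor_commute g).eq (glue u.1 u.2 ∘ π.symm)) (glue v.1 v.2)
    simp only [Matrix.mul_apply] at h1
    rw [h1, ← (Equiv.arrowCongr π (Equiv.refl κ)).sum_comp]
    refine sum_congr rfl fun k _ => ?_
    congr 1
    simp only [kroneckerFamily_apply]
    rw [← Equiv.prod_comp π]
    simp [Equiv.arrowCongr]

/-- Closing the remaining factors with `s` completes the contraction by `π` to a full trace. -/
lemma sum_contractedTensor (π : Perm (κ × κ)) (p : κ × κ → Prop) [DecidablePred p]
    (s : Perm {x // p x}) :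
    ∑ a, contractedTensor π p a (a ∘ s) = altTrace κ (π * Perm.ofSubtype s) := by
  rw [altTrace, ← (Equiv.arrowCongr π (Equiv.refl κ)).sum_comp, sum_glue p]
  refine sum_congr rfl fun a _ => ?_
  simp only [contractedTensor, Matrix.of_apply]
  refine sum_congr rfl fun c _ => ?_
  congr 1
  ext x
  by_cases hx : p x
  · rw [glue_of_pos _ _ hx]
    simp only [Equiv.arrowCongr, Function.comp_apply, Perm.mul_apply, Equiv.coe_fn_mk,
      Equiv.symm_apply_apply, Equiv.coe_refl, id]
    rw [Perm.ofSubtype_apply_of_mem s hx, glue_of_pos _ _ (s ⟨x, hx⟩).2]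
  · rw [glue_of_neg _ _ hx]
    simp only [Equiv.arrowCongr, Function.comp_apply, Perm.mul_apply, Equiv.coe_fn_mk,
      Equiv.symm_apply_apply, Equiv.coe_refl, id]
    rw [Perm.ofSubtype_apply_of_not_mem s hx, glue_of_neg _ _ hx]

end Contraction

/-! ### A nonzero doubly alternating trace along a single cycle -/

section FullCycleTrace

/-- A permutation `π` of the positions with nonzero alternating trace, and a choice of one point
in each cycle of `π`, such that all coefficients of the contracted tensor are nonzero. -/
lemma exists_contractedTensor_coeff (n : ℕ) : ∃ (π : Perm (Fin n × Fin n))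
    (p : Fin n × Fin n → Prop) (_ : DecidablePred p),
    (∀ x y, p x → p y → π.SameCycle x y → x = y) ∧ (∀ x, ∃ y, p y ∧ π.SameCycle y x) ∧
    ∃ c : ℚ, c ≠ 0 ∧ ∃ w : Perm {x // p x} → ℚ, (∀ s, w s ≠ 0) ∧
      (∀ a b, contractedTensor π p a b = ∑ s, w s * if a ∘ s = b then 1 else 0) ∧
      ∀ s : Perm {x // p x}, ∑ a, contractedTensor π p a (a ∘ s) = if s = 1 then c else 0 := by
  classical
  obtain ⟨π₁, hπ₁⟩ := exists_altTrace_ne_zero (κ := Fin n)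
  -- `numInvariant Bool π` is `2` to the number of cycles, so this `π` has the fewest cycles.
  obtain ⟨π, hπ, hmin⟩ := exists_min_image
    (univ.filter fun π : Perm (Fin n × Fin n) => altTrace (Fin n) π ≠ 0) (numInvariant Bool)
    ⟨π₁, by simpa using hπ₁⟩
  simp only [mem_filter, mem_univ, true_and] at hπ hmin
  let Q := Quotient (Perm.SameCycle.setoid π)
  let p : Fin n × Fin n → Prop := fun x => (Quotient.mk _ x : Q).out = x
  have hr1 : ∀ x y, p x → p y → π.SameCycle x y → x = y := by
    intro x y hx hy hxy
    have h1 : (Quotient.mk _ x : Q) = Quotient.mk _ y := Quotient.sound hxy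
    rw [← hx, ← hy, h1]
  have hr2 : ∀ x, ∃ y, p y ∧ π.SameCycle y x := by
    intro x
    refine ⟨(Quotient.mk _ x : Q).out, ?_, ?_⟩
    · simp only [p, Quotient.out_eq]
    · exact Quotient.exact (s := Perm.SameCycle.setoid π) (Quotient.out_eq _)
  have hcard : Fintype.card {x // p x} ≤ n := by
    have h1 := card_quotient_sameCycle_sq_le (centralizer_le_of_altTrace_ne_zero hπ)
    rw [Fintype.card_prod, Fintype.card_fin, ← sq, Nat.card_eq_fintype_card] at h1
    have h2 := (Nat.pow_le_pow_iff_left (by norm_num)).1 h1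
    refine le_trans (Fintype.card_le_of_injective (fun x : {x // p x} => (Quotient.mk _ x.1 : Q)) ?_) h2
    intro x y hxy
    exact Subtype.ext (hr1 _ _ x.2 y.2 (Quotient.exact hxy))
  have htr : ∀ s : Perm {x // p x}, ∑ a, contractedTensor π p a (a ∘ s) =
      if s = 1 then altTrace (Fin n) π else 0 := by
    intro s
    rw [sum_contractedTensor]
    split_ifs with hs
    · simp [hs]
    -- A nonzero trace would make `π * s` a competitor of `π`. Its invariant functions are also
    -- invariant under `π`, so by minimality the two have the same ones.
    by_contra hne
    have h1 := hmin _ hne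
    have hmv : ∀ x, Perm.ofSubtype s x ≠ x → p x := by
      intro x hx
      by_contra hpx
      exact hx (Perm.ofSubtype_apply_of_not_mem s hpx)
    have hmerge : ∀ f : Fin n × Fin n → Bool, f ∘ (π * Perm.ofSubtype s : Perm _) = f →
        f ∘ π = f := by
      intro f hf
      ext1 x
      exact apply_eq_of_apply_mul_eq π (Perm.ofSubtype s)
        (fun x y hxy hx hy => hr1 x y (hmv x hx) (hmv y hy) hxy) f (congrFun hf) x
    have h2 : (univ.filter fun f : Fin n × Fin n → Bool =>
        f ∘ (π * Perm.ofSubtype s : Perm _) = f) = univ.filter fun f => f ∘ π = f := by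
      refine eq_of_subset_of_card_le (fun f hf => ?_) h1
      simp only [mem_filter, mem_univ, true_and] at hf ⊢
      exact hmerge f hf
    apply hs
    ext1 x
    -- The indicator of the cycle of `x` is then invariant under `π * s`, which puts `s x` and `x`
    -- in one cycle of `π`; both are chosen points, so they agree.
    let f : Fin n × Fin n → Bool := fun y => decide (π.SameCycle x y)
    have hf : f ∘ π = f := by
      ext1 y; simp [f, Perm.sameCycle_apply_right]
    have hf2 : f ∈ univ.filter fun f : Fin n × Fin n → Bool =>
        f ∘ (π * Perm.ofSubtype s : Perm _) = f := by
      rw [h2]; simpa using hf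
    simp only [mem_filter, mem_univ, true_and] at hf2
    have h3 := congrFun hf2 x
    simp only [Function.comp_apply, Perm.mul_apply, Perm.ofSubtype_apply_coe, f,
      Perm.sameCycle_apply_right, decide_eq_decide] at h3
    exact Subtype.ext (hr1 _ _ (s x).2 x.2 (h3.2 (Perm.SameCycle.refl _ _)).symm)
  obtain ⟨w, hw⟩ := exists_perm_coeff (contractedTensor π p) fun g hg =>
    contractedTensor_commute π p g hg
  refine ⟨π, p, inferInstance, hr1, hr2, altTrace (Fin n) π, hπ, w, ?_, hw, htr⟩
  -- The traces of the expansion count functions with `a ∘ s = a ∘ ρ`; the substitution `s = g * ρ`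
  -- makes them invariant functions of `g`.
  refine weingarten_ne_zero hcard w hπ fun ρ => ?_
  rw [← htr ρ]
  simp_rw [hw]
  symm
  rw [sum_comm, ← Equiv.sum_comp (Equiv.mulRight ρ)]
  refine sum_congr rfl fun g _ => ?_
  rw [← mul_sum, numInvariant, Equiv.coe_mulRight, sum_boole]
  refine congrArg (fun k : ℕ => w (g * ρ) * (k : ℚ)) (congrArg Finset.card ?_)
  refine filter_congr fun a _ => ?_
  rw [Perm.coe_mul, ← Function.comp_assoc]
  exact ρ.surjective.right_cancellable

/-- The permutation of `α ⊕ α` that interchanges the two copies of the points with property `p`. -/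
def swapCopies {α : Type*} (p : α → Prop) [DecidablePred p] : Perm (α ⊕ α) :=
  Function.Involutive.toPerm
    (Sum.elim (fun x => if p x then Sum.inr x else Sum.inl x)
      (fun x => if p x then Sum.inl x else Sum.inr x))
    (by rintro (x | x) <;> by_cases hx : p x <;> simp [hx])

lemma swapCopies_inl {α : Type*} (p : α → Prop) [DecidablePred p] (x : α) :
    swapCopies p (Sum.inl x) = if p x then Sum.inr x else Sum.inl x := rfl

lemma swapCopies_inr {α : Type*} (p : α → Prop) [DecidablePred p] (x : α) :
    swapCopies p (Sum.inr x) = if p x then Sum.inl x else Sum.inr x := rfl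

/-- Two copies of `π`, joined along the points with property `p`. -/
def joinedPerm {α : Type*} [DecidableEq α] (π : Perm α) (p : α → Prop) [DecidablePred p]
    (ρ : Perm {x // p x}) : Perm (α ⊕ α) :=
  Perm.sumCongr π π * (Perm.sumCongr (Perm.ofSubtype ρ) 1 * swapCopies p)

/-- The factor after `π ⊔ π` moves only chosen points, one in each cycle, so an invariant function
is invariant under both factors. It sends a chosen point of the first copy to the second copy, and
one of the second copy to its `ρ`-successor in the first; as `ρ` is a full cycle, this links all
cycles. -/
lemma isFullCycle_joinedPerm {α : Type*} [Finite α] [DecidableEq α] (π : Perm α) (p : α → Prop)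
    [DecidablePred p] (hr1 : ∀ x y, p x → p y → π.SameCycle x y → x = y)
    (hr2 : ∀ x, ∃ y, p y ∧ π.SameCycle y x) (ρ : Perm {x // p x}) (hρ : IsFullCycle ρ) :
    IsFullCycle (joinedPerm π p ρ) := by
  intro f hf
  let s : Perm (α ⊕ α) := Perm.sumCongr (Perm.ofSubtype ρ) 1 * swapCopies p
  have hsl : ∀ x, p x → s (Sum.inl x) = Sum.inr x := fun x hx => by
    simp [s, swapCopies_inl, swapCopies_inr, hx]
  have hsl' : ∀ x, ¬ p x → s (Sum.inl x) = Sum.inl x := fun x hx => by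
    simp [s, swapCopies_inl, swapCopies_inr, hx, Perm.ofSubtype_apply_of_not_mem ρ hx]
  have hsr : ∀ x (hx : p x), s (Sum.inr x) = Sum.inl (ρ ⟨x, hx⟩).1 := fun x hx => by
    simp [s, swapCopies_inl, swapCopies_inr, hx, Perm.ofSubtype_apply_of_mem ρ hx]
  have hsr' : ∀ x, ¬ p x → s (Sum.inr x) = Sum.inr x := fun x hx => by
    simp [s, swapCopies_inl, swapCopies_inr, hx]
  have hzpow : ∀ k : ℤ, (Perm.sumCongr π π) ^ k = Perm.sumCongr (π ^ k) (π ^ k) := by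
    intro k
    exact (map_zpow (Perm.sumCongrHom α α) (π, π) k).symm
  have hinv : ∀ x, f (Perm.sumCongr π π x) = f x := by
    refine apply_eq_of_apply_mul_eq _ s ?_ f hf
    rintro (x | x) (y | y) ⟨k, hk⟩ hx hy <;> rw [hzpow] at hk
    · have h1 : π.SameCycle x y := ⟨k, by simpa using hk⟩
      rw [hr1 x y (by by_contra h; exact hx (hsl' x h)) (by by_contra h; exact hy (hsl' y h)) h1]
    · simp at hk
    · simp at hk
    · have h1 : π.SameCycle x y := ⟨k, by simpa using hk⟩
      rw [hr1 x y (by by_contra h; exact hx (hsr' x h)) (by by_contra h; exact hy (hsr' y h)) h1]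
  have hs : ∀ x, f (s x) = f x := fun x => by rw [← hf x, ← hinv (s x)]; rfl
  have hcyc : ∀ (k : ℤ) x, f (Perm.sumCongr (π ^ k) (π ^ k) x) = f x := by
    intro k x
    rw [← hzpow]
    induction k with
    | zero => simp
    | succ k ih =>
      rw [← ih, add_comm, zpow_add, zpow_one, Perm.mul_apply, hinv]
    | pred k ih =>
      rw [← ih, sub_eq_neg_add, zpow_add, zpow_neg_one, Perm.mul_apply,
        ← hinv ((Perm.sumCongr π π)⁻¹ _), ← Perm.mul_apply, mul_inv_cancel, Perm.one_apply]
  have hlr : ∀ x, p x → f (Sum.inl x) = f (Sum.inr x) := fun x hx => by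
    rw [← hs (Sum.inl x), hsl x hx]
  have hconst := hρ (fun x => f (Sum.inl x.1)) fun x => by
    change f (Sum.inl (ρ x).1) = f (Sum.inl x.1)
    rw [← hsr x.1 x.2, hs, hlr x.1 x.2]
  have hrep : ∀ z : α ⊕ α, ∃ y : {x // p x}, f z = f (Sum.inl y.1) := by
    rintro (x | x) <;> obtain ⟨y, hy, k, rfl⟩ := hr2 x
    · exact ⟨⟨y, hy⟩, by simpa using hcyc k (Sum.inl y)⟩
    · exact ⟨⟨y, hy⟩, by rw [hlr y hy]; simpa using hcyc k (Sum.inr y)⟩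
  intro x y
  obtain ⟨a, ha⟩ := hrep x
  obtain ⟨b, hb⟩ := hrep y
  rw [ha, hb]
  exact hconst a b

/-- The doubly alternating trace along a permutation of two copies of the positions. -/
def doubleAltTrace (κ : Type*) [Fintype κ] [DecidableEq κ] (w : Perm (κ × κ ⊕ κ × κ)) : ℚ :=
  ∑ h : κ × κ ⊕ κ × κ → κ, altTensor ℚ (fun i => h (Sum.inl i)) (fun i => h (w (Sum.inl i))) *
    altTensor ℚ (fun i => h (Sum.inr i)) (fun i => h (w (Sum.inr i)))

/-- The two copies interact only at the chosen points; all other positions are contracted within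
their own copy. -/
lemma doubleAltTrace_joinedPerm {κ : Type*} [Fintype κ] [DecidableEq κ] (π : Perm (κ × κ))
    (p : κ × κ → Prop) [DecidablePred p] (ρ : Perm {x // p x}) :
    doubleAltTrace κ (joinedPerm π p ρ) =
      ∑ a, ∑ b, contractedTensor π p a b * contractedTensor π p b (a ∘ ρ) := by
  -- Composing with `π⁻¹` in each copy moves `π` from the second arguments of the alternating
  -- tensors to the first ones, as in `contractedTensor`.
  let E : ((κ × κ → κ) × (κ × κ → κ)) ≃ (κ × κ ⊕ κ × κ → κ) :=
    ((Equiv.arrowCongr π (Equiv.refl κ)).prodCongr (Equiv.arrowCongr π (Equiv.refl κ))).trans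
      (Equiv.sumArrowEquivProdArrow _ _ _).symm
  rw [doubleAltTrace, ← E.sum_comp, Fintype.sum_prod_type, sum_glue p]
  have hEl : ∀ f g i, E (f, g) (Sum.inl i) = f (π.symm i) := fun _ _ _ => rfl
  have hEr : ∀ f g i, E (f, g) (Sum.inr i) = g (π.symm i) := fun _ _ _ => rfl
  have hE : ∀ (a b : {x // p x} → κ) (c d : {x // ¬ p x} → κ),
      altTensor ℚ (fun i => E (glue a c, glue b d) (Sum.inl i))
          (fun i => E (glue a c, glue b d) (joinedPerm π p ρ (Sum.inl i))) *
        altTensor ℚ (fun i => E (glue a c, glue b d) (Sum.inr i))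
          (fun i => E (glue a c, glue b d) (joinedPerm π p ρ (Sum.inr i))) =
      altTensor ℚ (glue a c ∘ π.symm) (glue b c) *
        altTensor ℚ (glue b d ∘ π.symm) (glue (a ∘ ρ) d) := by
    intro a b c d
    congr 2
    · ext i
      by_cases hi : p i
      · simp [hEl, hEr, joinedPerm, swapCopies_inl, swapCopies_inr, hi, glue_of_pos]
      · simp [hEl, hEr, joinedPerm, swapCopies_inl, swapCopies_inr, hi, glue_of_neg,
          Perm.ofSubtype_apply_of_not_mem ρ hi]
    · ext i
      by_cases hi : p i
      · simp [hEl, hEr, joinedPerm, swapCopies_inl, swapCopies_inr, hi, glue_of_pos,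
          Perm.ofSubtype_apply_of_mem ρ hi, (ρ ⟨i, hi⟩).2]
      · simp [hEl, hEr, joinedPerm, swapCopies_inl, swapCopies_inr, hi, glue_of_neg]
  refine sum_congr rfl fun a _ => ?_
  simp_rw [sum_glue p (fun g : κ × κ → κ => _), hE]
  rw [sum_comm]
  refine sum_congr rfl fun b _ => ?_
  simp only [contractedTensor, Matrix.of_apply, sum_mul_sum]

/-- Expanding the second contracted tensor leaves `∑ s, w s` times the trace of the first against `ρ
* s⁻¹`, which is `c` for `s = ρ` and zero otherwise. The value is `w ρ * c`. -/
theorem exists_doubleAltTrace_ne_zero (n : ℕ) (hn : n ≠ 0) :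
    ∃ w : Perm (Fin n × Fin n ⊕ Fin n × Fin n),
      IsFullCycle w ∧ doubleAltTrace (Fin n) w ≠ 0 := by
  obtain ⟨π, p, _, hr1, hr2, c, hc, w, hw0, hw, htr⟩ := exists_contractedTensor_coeff n
  have : NeZero n := ⟨hn⟩
  have : Nonempty {x // p x} := by
    obtain ⟨y, hy, -⟩ := hr2 (0, 0)
    exact ⟨⟨y, hy⟩⟩
  obtain ⟨ρ, hρ⟩ := exists_isFullCycle {x // p x}
  refine ⟨joinedPerm π p ρ, isFullCycle_joinedPerm π p hr1 hr2 ρ hρ, ?_⟩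
  have h1 : doubleAltTrace (Fin n) (joinedPerm π p ρ) = w ρ * c := by
    have h2 : ∀ a b : {x // p x} → Fin n, contractedTensor π p b (a ∘ ρ) =
        ∑ s, w s * if b = a ∘ (ρ * s⁻¹ : Perm _) then 1 else 0 := by
      intro a b
      rw [hw]
      refine sum_congr rfl fun s _ => ?_
      congr 2
      rw [Perm.coe_mul, ← Function.comp_assoc, Perm.coe_inv, Equiv.eq_comp_symm]
    rw [doubleAltTrace_joinedPerm]
    have h3 : ∀ a : {x // p x} → Fin n,
        ∑ b, contractedTensor π p a b * contractedTensor π p b (a ∘ ρ) =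
        ∑ s, w s * contractedTensor π p a (a ∘ (ρ * s⁻¹ : Perm _)) := by
      intro a
      simp_rw [h2, mul_sum]
      rw [sum_comm]
      refine sum_congr rfl fun s _ => ?_
      rw [sum_eq_single (a ∘ (ρ * s⁻¹ : Perm _)) (fun b _ hb => by rw [if_neg hb]; ring) (by simp)]
      rw [if_pos rfl]; ring
    simp_rw [h3]
    rw [sum_comm]
    simp_rw [← mul_sum, htr]
    rw [sum_eq_single ρ]
    · simp
    · intro s _ hs
      rw [if_neg, mul_zero]
      intro h
      exact hs (mul_inv_eq_one.1 h).symm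
    · simp
  rw [h1]
  exact mul_ne_zero (hw0 ρ) hc

end FullCycleTrace

/-! ### Traces of words as sums over closed paths -/

section MatrixProducts

variable {κ R : Type*} [Fintype κ] [DecidableEq κ] [CommRing R]

lemma prod_ofFn_apply {m : ℕ} (z : Fin m → Matrix κ κ R) (a b : κ) :
    (List.ofFn z).prod a b = ∑ h : Fin (m + 1) → κ,
      (if h 0 = a ∧ h (Fin.last m) = b then 1 else 0) * ∏ i, z i (h i.castSucc) (h i.succ) := by
  induction m generalizing a with
  | zero =>
    rw [← (Fin.consEquiv fun _ => κ).sum_comp, Fintype.sum_prod_type]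
    simp only [List.ofFn_zero, List.prod_nil, Matrix.one_apply, Fin.consEquiv_apply,
      Fintype.sum_unique, univ_eq_empty, prod_empty, mul_one, Fin.cons_zero, Fin.isValue,
      Fin.last_zero]
    rw [sum_eq_single a (fun x _ hx => by simp [hx]) (by simp)]
    simp
  | succ m ih =>
    rw [List.ofFn_succ, List.prod_cons, Matrix.mul_apply,
      ← (Fin.consEquiv fun _ => κ).sum_comp, Fintype.sum_prod_type]
    symm
    rw [sum_eq_single a (fun x _ hx => by
      refine sum_eq_zero fun h _ => ?_
      simp [Fin.consEquiv_apply, hx]) (by simp)]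
    simp_rw [ih, mul_sum]
    rw [sum_comm]
    refine sum_congr rfl fun h _ => ?_
    rw [sum_eq_single (h 0) (fun x _ hx => by simp [hx.symm]) (by simp)]
    rw [Fin.prod_univ_succ]
    simp only [Fin.consEquiv_apply, Fin.cons_zero, true_and, ← Fin.succ_last, Fin.cons_succ,
      Fin.castSucc_zero, ← Fin.succ_castSucc]
    ring

lemma trace_prod_ofFn {m : ℕ} (z : Fin (m + 1) → Matrix κ κ R) :
    (List.ofFn z).prod.trace = ∑ h : Fin (m + 1) → κ, ∏ i, z i (h i) (h (finRotate (m + 1) i)) := by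
  simp only [Matrix.trace, Matrix.diag_apply, prod_ofFn_apply]
  rw [sum_comm, ← (Fin.snocEquiv fun _ => κ).sum_comp, Fintype.sum_prod_type, sum_comm]
  refine sum_congr rfl fun h _ => ?_
  have h0 : ∀ a, (Fin.snoc h a : Fin (m + 2) → κ) 0 = h 0 := fun a => by
    rw [show (0 : Fin (m + 2)) = Fin.castSucc 0 from rfl, Fin.snoc_castSucc]
  rw [sum_eq_single (h 0)]
  · rw [sum_eq_single (h 0)]
    · simp only [Fin.snocEquiv_apply, Fin.snoc_last, and_true]
      rw [if_pos (h0 _), one_mul]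
      refine prod_congr rfl fun i _ => ?_
      rw [Fin.snoc_castSucc]
      congr 1
      refine Fin.lastCases ?_ (fun i => ?_) i
      · simp
      · rw [Fin.succ_castSucc, Fin.snoc_castSucc, finRotate_apply, Fin.coeSucc_eq_succ]
    · intro a _ ha
      rw [if_neg, zero_mul]
      simp only [Fin.snocEquiv_apply, Fin.snoc_last]
      exact fun h' => ha h'.2.symm
    · simp
  · intro a _ ha
    refine sum_eq_zero fun b _ => ?_
    rw [if_neg, zero_mul]
    simp only [Fin.snocEquiv_apply, Fin.snoc_last]
    rw [h0]
    rintro ⟨h1, h2⟩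
    exact ha (h2.trans h1.symm)
  · simp

/-- A full cycle moves every point, so it is conjugate to `finRotate`. At least two points are
needed: on one point it is the identity, which is not `IsCycle`. -/
lemma exists_equiv_finRotate {α : Type*} [Fintype α] [DecidableEq α] {w : Perm α}
    (hw : IsFullCycle w) {m : ℕ} (hm : Fintype.card α = m + 2) :
    ∃ e : Fin (m + 2) ≃ α, ∀ i, w (e i) = e (finRotate (m + 2) i) := by
  have hcard : 1 < Fintype.card α := by omega
  have hmv : ∀ x, w x ≠ x := by
    intro x hx
    obtain ⟨y, hy⟩ := Fintype.exists_ne_of_one_lt_card hcard x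
    have := hw (fun z => z = x) (fun z => by
      refine propext ⟨fun h => w.injective (h.trans hx.symm), fun h => by rw [h, hx]⟩) x y
    simp only [eq_iff_iff, true_iff] at this
    exact hy this
  have hcyc : w.IsCycle := by
    have : Nonempty α := Fintype.card_pos_iff.1 (by omega)
    refine ⟨Classical.arbitrary α, hmv _, fun y _ => ?_⟩
    have := hw (fun z => w.SameCycle (Classical.arbitrary α) z)
      (fun z => propext Perm.sameCycle_apply_right) (Classical.arbitrary α) y
    exact this.mp (Perm.SameCycle.refl _ _)
  let e₀ : α ≃ Fin (m + 2) := Fintype.equivFinOfCardEq hm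
  have hcyc' : (e₀.permCongr w).IsCycle := by
    obtain ⟨x, hx, hx'⟩ := hcyc
    refine ⟨e₀ x, by simpa using hx, fun y hy => ?_⟩
    obtain ⟨k, hk⟩ := hx' (y := e₀.symm y) (hmv _)
    refine ⟨k, ?_⟩
    have : (e₀.permCongr w) ^ k = e₀.permCongr (w ^ k) := (map_zpow e₀.permCongrHom w k).symm
    rw [this]
    simp [hk]
  have hsupp : (e₀.permCongr w).support = univ := by
    ext x
    have := hmv (e₀.symm x)
    simpa [← Equiv.eq_symm_apply] using this
  obtain ⟨c, hc⟩ := isConj_iff.1 (Perm.IsCycle.isConj isCycle_finRotate hcyc'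
    (by rw [hsupp, support_finRotate]))
  refine ⟨c.trans e₀.symm, fun i => ?_⟩
  have h1 := Equiv.congr_fun hc (c i)
  simp only [Perm.mul_apply, Perm.coe_inv, Equiv.symm_apply_apply, Equiv.permCongr_apply] at h1
  simp only [Equiv.trans_apply]
  rw [h1, Equiv.symm_apply_apply]

end MatrixProducts

/-! ### Doubly alternating sums with nonzero scalar values on matrices -/

section RegevSum

/-- The sum over all permutations of the variables of both kinds, with signs, of the values of a
word in two sets of variables. -/
def regevSum {ι B : Type*} [Fintype ι] [DecidableEq ι] [Ring B] (word : List (ι ⊕ ι))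
    (x y : ι → B) : B :=
  ∑ σ : Perm ι, ∑ τ : Perm ι, ((Perm.sign σ : ℤ) * (Perm.sign τ : ℤ)) •
    (word.map (Sum.elim (x ∘ σ) (y ∘ τ))).prod

variable {κ R : Type*} [Fintype κ] [DecidableEq κ] [CommRing R]

lemma sum_sign_prod_sum (x y : κ × κ → Matrix κ κ R) (f g : κ × κ ⊕ κ × κ → κ) :
    ∑ σ : Perm (κ × κ), ∑ τ : Perm (κ × κ), ((Perm.sign σ : ℤ) * (Perm.sign τ : ℤ) : R) *
      ∏ j, (Sum.elim (x ∘ σ) (y ∘ τ) : _ → Matrix κ κ R) j (f j) (g j) =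
    ((coordMatrix x).det * (coordMatrix y).det) *
      (altTensor R (fun i => f (Sum.inl i)) (fun i => g (Sum.inl i)) *
      altTensor R (fun i => f (Sum.inr i)) (fun i => g (Sum.inr i))) := by
  rw [mul_mul_mul_comm, ← sum_sign_prod_eq, ← sum_sign_prod_eq, sum_mul_sum]
  refine sum_congr rfl fun σ _ => sum_congr rfl fun τ _ => ?_
  rw [Fintype.prod_sum_type]
  simp only [Sum.elim_inl, Sum.elim_inr, Function.comp_apply]
  ring

lemma regevSum_ofFn_apply {m : ℕ} (e : Fin m ≃ κ × κ ⊕ κ × κ) (x y : κ × κ → Matrix κ κ R)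
    (a b : κ) : regevSum (List.ofFn e) x y a b =
      ((coordMatrix x).det * (coordMatrix y).det) * ∑ h : Fin (m + 1) → κ,
        (if h 0 = a ∧ h (Fin.last m) = b then 1 else 0) *
        (altTensor R (fun i => h (e.symm (Sum.inl i)).castSucc)
          (fun i => h (e.symm (Sum.inl i)).succ) *
        altTensor R (fun i => h (e.symm (Sum.inr i)).castSucc)
          (fun i => h (e.symm (Sum.inr i)).succ)) := by
  have h1 : ∀ h : Fin (m + 1) → κ, ∀ z : κ × κ ⊕ κ × κ → Matrix κ κ R,
      ∏ i, z (e i) (h i.castSucc) (h i.succ) =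
      ∏ j, z j (h (e.symm j).castSucc) (h (e.symm j).succ) := by
    intro h z
    rw [← e.prod_comp]
    simp
  simp only [regevSum, List.map_ofFn, Matrix.sum_apply, Matrix.smul_apply, prod_ofFn_apply,
    Function.comp_apply, h1]
  simp only [zsmul_eq_mul, mul_sum]
  push_cast
  have h2 : ∀ h : Fin (m + 1) → κ,
      ((coordMatrix x).det * (coordMatrix y).det) *
        ((if h 0 = a ∧ h (Fin.last m) = b then 1 else 0) *
        (altTensor R (fun i => h (e.symm (Sum.inl i)).castSucc)
          (fun i => h (e.symm (Sum.inl i)).succ) *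
        altTensor R (fun i => h (e.symm (Sum.inr i)).castSucc)
          (fun i => h (e.symm (Sum.inr i)).succ))) =
      ∑ σ : Perm (κ × κ), ∑ τ : Perm (κ × κ), ((Perm.sign σ : ℤ) * (Perm.sign τ : ℤ) : R) *
      ((if h 0 = a ∧ h (Fin.last m) = b then 1 else 0) *
      ∏ j, (Sum.elim (x ∘ σ) (y ∘ τ) : _ → Matrix κ κ R) j (h (e.symm j).castSucc)
        (h (e.symm j).succ)) := by
    intro h
    rw [mul_left_comm, ← sum_sign_prod_sum x y (fun j => h (e.symm j).castSucc)
      (fun j => h (e.symm j).succ), mul_sum]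
    refine sum_congr rfl fun σ _ => ?_
    rw [mul_sum]
    refine sum_congr rfl fun τ _ => ?_
    ring
  simp_rw [h2]
  rw [sum_comm]
  simp_rw [sum_comm (s := (univ : Finset (Fin (m + 1) → κ))) (t := (univ : Finset (Perm (κ × κ))))]
  rw [sum_comm]

/-- The two families enter only through their coordinate determinants, so the matrix units decide
every case. -/
lemma regevSum_eq_smul {m : ℕ} (e : Fin m ≃ κ × κ ⊕ κ × κ) (x y : κ × κ → Matrix κ κ R) :
    regevSum (List.ofFn e) x y = ((coordMatrix x).det * (coordMatrix y).det) •
      regevSum (List.ofFn e) (matrixUnit R) (matrixUnit R) := by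
  ext a b
  rw [Matrix.smul_apply, regevSum_ofFn_apply, regevSum_ofFn_apply, coordMatrix_matrixUnit,
    Matrix.det_one, one_mul, one_mul, smul_eq_mul]

lemma prod_map_conj {B α : Type*} [Monoid B] (t t' : B) (h : t * t' = 1) (h' : t' * t = 1)
    (l : List α) (z : α → B) :
    (l.map fun i => t * z i * t').prod = t * (l.map z).prod * t' := by
  induction l with
  | nil => simp [h]
  | cons a l ih =>
    rw [List.map_cons, List.prod_cons, ih, List.map_cons, List.prod_cons]
    calc t * z a * t' * (t * (l.map z).prod * t')
        = t * z a * (t' * t) * (l.map z).prod * t' := by simp only [mul_assoc]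
      _ = t * (z a * (l.map z).prod) * t' := by rw [h', mul_one]; simp only [mul_assoc]

lemma regevSum_conj {ι B : Type*} [Fintype ι] [DecidableEq ι] [Ring B] (word : List (ι ⊕ ι))
    (x y : ι → B) (t t' : B) (h : t * t' = 1) (h' : t' * t = 1) :
    regevSum word (fun i => t * x i * t') (fun i => t * y i * t') =
      t * regevSum word x y * t' := by
  simp only [regevSum, mul_sum, sum_mul]
  refine sum_congr rfl fun σ _ => sum_congr rfl fun τ _ => ?_
  rw [mul_smul_comm, smul_mul_assoc, ← prod_map_conj t t' h h']
  congr 3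
  ext1 (i | i) <;> rfl

lemma coordMatrix_conj_matrixUnit (t t' : Matrix κ κ R) :
    coordMatrix (fun i => t * matrixUnit R i * t') =
      Matrix.kroneckerMap (· * ·) t.transpose t' := by
  ext i p
  simp only [coordMatrix, matrixUnit, Matrix.of_apply, Matrix.kroneckerMap_apply, Matrix.mul_apply,
    Matrix.single_apply, Matrix.transpose_apply]
  rw [sum_eq_single i.2 (fun b _ hb => by simp [hb.symm]) (by simp),
    sum_eq_single i.1 (fun b _ hb => by simp [hb.symm]) (by simp)]
  simp

/-- Conjugating the matrix units by a transvection has coordinate determinant `1`, so the value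
commutes with all transvections. -/
lemma regevSum_matrixUnit_mem_range_scalar {m : ℕ} (e : Fin m ≃ κ × κ ⊕ κ × κ) :
    regevSum (List.ofFn e) (matrixUnit R) (matrixUnit R) ∈ Set.range (Matrix.scalar κ) := by
  refine Matrix.mem_range_scalar_of_commute_transvectionStruct fun t => ?_
  have h1 := regevSum_conj (List.ofFn e) (matrixUnit R) (matrixUnit R) t.toMatrix t.inv.toMatrix
    t.mul_inv t.inv_mul
  rw [regevSum_eq_smul, coordMatrix_conj_matrixUnit, Matrix.det_kronecker] at h1
  simp only [Matrix.det_transpose, Matrix.TransvectionStruct.det, one_pow, one_mul, one_smul] at h1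
  rw [Commute, SemiconjBy]
  conv_rhs => rw [h1]
  rw [mul_assoc, t.inv_mul, mul_one]

/-- The closed path of the trace runs through the positions in the order of the cycle `w`, and the
two alternating sums factor for each path. -/
lemma trace_regevSum_matrixUnit {m : ℕ} (e : Fin (m + 1) ≃ κ × κ ⊕ κ × κ)
    (w : Perm (κ × κ ⊕ κ × κ)) (hw : ∀ i, w (e i) = e (finRotate (m + 1) i)) :
    (regevSum (List.ofFn e) (matrixUnit ℚ) (matrixUnit ℚ)).trace = doubleAltTrace κ w := by
  have h1 : ∀ z : κ × κ ⊕ κ × κ → Matrix κ κ ℚ,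
      ∑ h : Fin (m + 1) → κ, ∏ i, z (e i) (h i) (h (finRotate (m + 1) i)) =
      ∑ h : κ × κ ⊕ κ × κ → κ, ∏ j, z j (h j) (h (w j)) := by
    intro z
    rw [← (Equiv.arrowCongr e (Equiv.refl κ)).sum_comp]
    refine sum_congr rfl fun h _ => ?_
    rw [← e.prod_comp]
    refine prod_congr rfl fun i _ => ?_
    simp [Equiv.arrowCongr, hw]
  simp only [regevSum, Matrix.trace_sum, Matrix.trace_smul, List.map_ofFn, trace_prod_ofFn,
    Function.comp_apply, h1]
  simp only [zsmul_eq_mul, mul_sum]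
  push_cast
  have h2 := fun h : κ × κ ⊕ κ × κ → κ =>
    sum_sign_prod_sum (matrixUnit ℚ) (matrixUnit ℚ) h (fun j => h (w j))
  simp only [coordMatrix_matrixUnit, Matrix.det_one, one_mul] at h2
  rw [doubleAltTrace]
  simp_rw [← h2]
  rw [sum_comm (s := (univ : Finset (κ × κ ⊕ κ × κ → κ)))]
  simp_rw [sum_comm (s := (univ : Finset (κ × κ ⊕ κ × κ → κ)))]

lemma map_regevSum {ι B C : Type*} [Fintype ι] [DecidableEq ι] [Ring B] [Ring C] (f : B →+* C)
    (word : List (ι ⊕ ι)) (x y : ι → B) :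
    f (regevSum word x y) = regevSum word (f ∘ x) (f ∘ y) := by
  simp only [regevSum, map_sum, map_zsmul, map_list_prod, List.map_map]
  refine sum_congr rfl fun σ _ => sum_congr rfl fun τ _ => ?_
  congr 3
  ext1 (i | i) <;> rfl

/-- For every `n ≥ 1` there is a word, containing each of two sets of `n²` variables exactly once,
such that the alternating sum over both sets takes a nonzero scalar value on any basis of the
`n × n` matrices. -/
theorem exists_word_regevSum_eq_scalar (F : Type*) [Field F] [CharZero F] {n : ℕ} (hn : n ≠ 0) :
    ∃ word : List (Fin n × Fin n ⊕ Fin n × Fin n),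
      (word : Multiset (Fin n × Fin n ⊕ Fin n × Fin n)) = univ.val ∧
      ∀ b : Fin n × Fin n → Matrix (Fin n) (Fin n) F, LinearIndependent F b →
        ∃ c : F, c ≠ 0 ∧ regevSum word b b = Matrix.scalar (Fin n) c := by
  obtain ⟨w, hw, hT⟩ := exists_doubleAltTrace_ne_zero n hn
  obtain ⟨k, rfl⟩ := Nat.exists_eq_succ_of_ne_zero hn
  have hcard : Fintype.card (Fin (k + 1) × Fin (k + 1) ⊕ Fin (k + 1) × Fin (k + 1)) =
      (2 * (k * k + 2 * k)) + 2 := by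
    simp; ring
  obtain ⟨e, he⟩ := exists_equiv_finRotate hw hcard
  refine ⟨List.ofFn e, ?_, fun b hb => ?_⟩
  · rw [← Finset.map_univ_equiv e]
    simp only [Finset.map_val, Fin.univ_def, Multiset.map_coe]
    rw [List.ofFn_eq_map]; rfl
  have hdet : (coordMatrix b).det ≠ 0 := by
    rw [← isUnit_iff_ne_zero, ← Matrix.isUnit_iff_isUnit_det,
      ← Matrix.linearIndependent_rows_iff_isUnit]
    let L : Matrix (Fin (k + 1)) (Fin (k + 1)) F →ₗ[F] (Fin (k + 1) × Fin (k + 1) → F) :=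
      { toFun := fun M p => M p.1 p.2, map_add' := fun _ _ => rfl, map_smul' := fun _ _ => rfl }
    exact hb.map' L (LinearMap.ker_eq_bot.2 fun M N h => by
      ext i j; exact congrFun h (i, j))
  obtain ⟨c, hc⟩ := regevSum_matrixUnit_mem_range_scalar (R := F) e
  refine ⟨(coordMatrix b).det * (coordMatrix b).det * c, ?_, ?_⟩
  · refine mul_ne_zero (mul_ne_zero hdet hdet) ?_
    rintro rfl
    apply hT
    rw [← trace_regevSum_matrixUnit e w he]
    -- The nonzero trace is known over `ℚ`. As `ℚ → F` is injective and matches the matrix units, `c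
    -- = 0` would make the rational value vanish.
    have h1 := map_regevSum (algebraMap ℚ F).mapMatrix (List.ofFn e) (matrixUnit ℚ) (matrixUnit ℚ)
    have h2 : (algebraMap ℚ F).mapMatrix ∘ matrixUnit ℚ =
        (matrixUnit F : _ → Matrix (Fin (k + 1)) (Fin (k + 1)) F) := by
      ext1 i
      simp [matrixUnit]
    rw [h2, ← hc, map_zero] at h1
    have h3 := (map_eq_zero_iff _ (Matrix.map_injective (algebraMap ℚ F).injective)).1 h1
    rw [h3, Matrix.trace_zero]
  · rw [regevSum_eq_smul, ← hc]
    ext i j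
    simp [Matrix.diagonal_apply]

end RegevSum

end GradedPI

namespace GradedPI

open Finset

/-! ### Graded simple algebras: homogeneous components and idempotence -/

section GradedStructure

variable {F G A : Type*} [Field F] [CommGroup G] [Fintype G] [DecidableEq G]
  [NonUnitalRing A] [Module F A] [IsScalarTower F A A] [SMulCommClass F A A]
  {𝒜 : G → Submodule F A}

lemma IsGrading.exists_sum_eq (h : IsGrading 𝒜) (a : A) :
    ∃ f : G → A, (∀ g, f g ∈ 𝒜 g) ∧ ∑ g, f g = a := by
  have ha : a ∈ ⨆ g, 𝒜 g := by rw [h.isInternal.submodule_iSup_eq_top]; trivial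
  obtain ⟨f, hf⟩ := (Submodule.mem_iSup_iff_exists_finsupp 𝒜 a).1 ha
  exact ⟨f, hf.1, by rw [← hf.2, Finsupp.sum_fintype _ _ (by simp)]⟩

lemma IsGrading.eq_zero_of_sum_eq_zero (h : IsGrading 𝒜) {f : G → A} (hf : ∀ g, f g ∈ 𝒜 g)
    (h0 : ∑ g, f g = 0) (g : G) : f g = 0 := by
  have := (iSupIndep_iff_finsetSum_eq_zero_imp_eq_zero 𝒜).1
    h.isInternal.submodule_iSupIndep univ f (fun g _ => hf g) h0
  exact this g (mem_univ g)

/-- A family of subspaces of the homogeneous components that is stable under multiplication is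
trivial in a graded simple algebra. -/
lemma IsGradedSimple.eq_bot_or_eq (h : IsGrading 𝒜) (hs : IsGradedSimple 𝒜)
    (I : G → Submodule F A) (hle : ∀ g, I g ≤ 𝒜 g)
    (hl : ∀ g k a x, a ∈ 𝒜 g → x ∈ I k → a * x ∈ I (g * k))
    (hr : ∀ g k a x, a ∈ 𝒜 g → x ∈ I k → x * a ∈ I (g * k)) :
    (∀ g, I g = ⊥) ∨ ∀ g, I g = 𝒜 g := by
  have hJ : IsGradedIdeal 𝒜 (⨆ g, I g) := by
    refine ⟨fun a x hx => ?_, fun a x hx => ?_, le_antisymm ?_ ?_⟩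
    · obtain ⟨f, hf, rfl⟩ := h.exists_sum_eq a
      induction hx using Submodule.iSup_induction' with
      | mem k x hx =>
        rw [sum_mul]
        exact Submodule.sum_mem _ fun g _ => Submodule.mem_iSup_of_mem (g * k) (hl g k _ _ (hf g) hx)
      | zero => simp
      | add x y _ _ hx hy => rw [mul_add]; exact Submodule.add_mem _ hx hy
    · obtain ⟨f, hf, rfl⟩ := h.exists_sum_eq a
      induction hx using Submodule.iSup_induction' with
      | mem k x hx =>
        rw [mul_sum]
        exact Submodule.sum_mem _ fun g _ => Submodule.mem_iSup_of_mem (g * k) (hr g k _ _ (hf g) hx)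
      | zero => simp
      | add x y _ _ hx hy => rw [add_mul]; exact Submodule.add_mem _ hx hy
    · exact iSup_mono fun g => le_inf (le_iSup I g) (hle g)
    · exact iSup_le fun g => inf_le_left
  rcases hs.eq_bot_or_eq_top _ hJ with h1 | h1
  · left
    exact fun g => le_bot_iff.1 (h1 ▸ le_iSup I g)
  · right
    refine fun g => le_antisymm (hle g) fun x hx => ?_
    have hx' : x ∈ ⨆ g, I g := h1 ▸ Submodule.mem_top
    obtain ⟨f, hf⟩ := (Submodule.mem_iSup_iff_exists_finsupp I x).1 hx'
    -- Comparing homogeneous components shows that `x` is its own summand of degree `g`.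
    have h2 := h.eq_zero_of_sum_eq_zero (f := fun k => f k - if k = g then x else 0) (fun k => by
      refine Submodule.sub_mem _ (hle k (hf.1 k)) ?_
      split_ifs with hk
      · exact hk ▸ hx
      · exact Submodule.zero_mem _) (by
      rw [sum_sub_distrib, sum_ite_eq' univ g, ← hf.2, Finsupp.sum_fintype _ _ (by simp)]
      simp) g
    simp only [if_true] at h2
    rw [← sub_eq_zero.1 h2]
    exact hf.1 g

/-- The homogeneous parts of `A²` form a stable family that is not zero, so `A² = A`. -/
lemma IsGradedSimple.mem_span_mul (h : IsGrading 𝒜) (hs : IsGradedSimple 𝒜) (a : A) :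
    a ∈ Submodule.span F {x : A | ∃ b c, x = b * c} := by
  let S := Submodule.span F {x : A | ∃ b c, x = b * c}
  have hS : ∀ b c : A, b * c ∈ S := fun b c => Submodule.subset_span ⟨b, c, rfl⟩
  have h1 := hs.eq_bot_or_eq h (fun g => S ⊓ 𝒜 g) (fun g => inf_le_right)
    (fun g k a x ha hx => ⟨hS _ _, h.mul_mem ha hx.2⟩)
    (fun g k a x ha hx => ⟨hS _ _, mul_comm k g ▸ h.mul_mem hx.2 ha⟩)
  rcases h1 with h1 | h1
  · exfalso
    obtain ⟨b, c, hbc⟩ := hs.exists_mul_ne_zero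
    obtain ⟨f, hf, rfl⟩ := h.exists_sum_eq b
    obtain ⟨f', hf', rfl⟩ := h.exists_sum_eq c
    apply hbc
    rw [sum_mul_sum]
    refine sum_eq_zero fun g _ => sum_eq_zero fun k _ => ?_
    have : f g * f' k ∈ S ⊓ 𝒜 (g * k) := ⟨hS _ _, h.mul_mem (hf g) (hf' k)⟩
    rw [h1] at this
    exact this
  · obtain ⟨f, hf, rfl⟩ := h.exists_sum_eq a
    refine Submodule.sum_mem _ fun g _ => ?_
    have := hf g
    rw [← h1 g] at this
    exact this.1

end GradedStructure

/-! ### A matrix algebra as a quotient -/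

section MatrixQuotient

variable {F A : Type*} [Field F] [NonUnitalRing A] [Module F A] [IsScalarTower F A A]
  [SMulCommClass F A A]

/-- A nonzero idempotent ideal of a finite dimensional algebra over an algebraically closed field
maps onto a full matrix algebra. -/
lemma exists_surjective_matrix_of_ideal {U : Type*} [Ring U] [Algebra F U] [FiniteDimensional F U]
    [IsAlgClosed F] (j : A →ₙₐ[F] U) (hj : Function.Injective j)
    (hl : ∀ u a, ∃ b, j b = u * j a) (hr : ∀ u a, ∃ b, j b = j a * u)
    (hA : ∀ a : A, a ∈ Submodule.span F {x : A | ∃ b c, x = b * c}) (hne : ∃ a : A, a ≠ 0) :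
    ∃ n : ℕ, n ≠ 0 ∧ ∃ p : A →ₙₐ[F] Matrix (Fin n) (Fin n) F, Function.Surjective p := by
  have : IsArtinianRing U := IsArtinianRing.of_finite F U
  -- An idempotent ideal inside the radical would lie in all of its powers, hence be zero.
  obtain ⟨a₀, hJ⟩ : ∃ a : A, j a ∉ Ring.jacobson U := by
    by_contra! hcon
    obtain ⟨N, hN⟩ := IsSemiprimaryRing.isNilpotent (R := U)
    have hpow : ∀ k : ℕ, ∀ a : A, j a ∈ Ring.jacobson U ^ k := by
      intro k
      induction k with
      | zero =>
        intro a
        rw [Submodule.pow_zero, Ideal.one_eq_top]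
        trivial
      | succ k ih =>
        intro a
        induction hA a using Submodule.span_induction with
        | mem x hx =>
          obtain ⟨b, c, rfl⟩ := hx
          rw [map_mul, Submodule.pow_succ]
          exact Ideal.mul_mem_mul (ih b) (hcon c)
        | zero => simp
        | add x y _ _ hx hy => rw [map_add]; exact Ideal.add_mem _ hx hy
        | smul r x _ hx =>
          rw [map_smul, ← smul_one_mul]
          exact Ideal.mul_mem_left _ _ hx
    obtain ⟨a, ha⟩ := hne
    have h1 := hpow N a
    rw [hN] at h1
    exact ha (hj (h1.trans (map_zero j).symm))
  obtain ⟨m, d, hd, ⟨e⟩⟩ :=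
    IsSemisimpleRing.exists_algEquiv_pi_matrix_of_isAlgClosed F (U ⧸ Ring.jacobson U)
  let q : U →ₐ[F] (i : Fin m) → Matrix (Fin (d i)) (Fin (d i)) F :=
    (e : _ →ₐ[F] _).comp (Ideal.Quotient.mkₐ F (Ring.jacobson U))
  have hq : Function.Surjective q := e.surjective.comp Ideal.Quotient.mk_surjective
  have hqa : q (j a₀) ≠ 0 := by
    intro h0
    apply hJ
    have : e (Ideal.Quotient.mk _ (j a₀)) = 0 := h0
    rw [map_eq_zero_iff _ e.injective] at this
    exact Ideal.Quotient.eq_zero_iff_mem.1 this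
  obtain ⟨i, hi⟩ := Function.ne_iff.1 hqa
  have hdi := (hd i).out
  refine ⟨d i, hdi, ?_⟩
  let π : U →ₐ[F] Matrix (Fin (d i)) (Fin (d i)) F := (Pi.evalAlgHom F _ i).comp q
  have hπ : Function.Surjective π := (Function.surjective_eval i).comp hq
  let p : A →ₙₐ[F] Matrix (Fin (d i)) (Fin (d i)) F := (π : U →ₙₐ[F] _).comp j
  have hp : ∀ a, p a = π (j a) := fun _ => rfl
  refine ⟨p, ?_⟩
  -- The image of the ideal is a nonzero ideal of a simple ring.
  let I : TwoSidedIdeal (Matrix (Fin (d i)) (Fin (d i)) F) := TwoSidedIdeal.mk' (Set.range p)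
    ⟨0, map_zero p⟩
    (by rintro _ _ ⟨a, rfl⟩ ⟨b, rfl⟩; exact ⟨a + b, map_add p a b⟩)
    (by rintro _ ⟨a, rfl⟩; exact ⟨-a, map_neg p a⟩)
    (by
      rintro x _ ⟨a, rfl⟩
      obtain ⟨u, rfl⟩ := hπ x
      obtain ⟨b, hb⟩ := hl u a
      exact ⟨b, by rw [hp, hp, hb, map_mul]⟩)
    (by
      rintro _ x ⟨a, rfl⟩
      obtain ⟨u, rfl⟩ := hπ x
      obtain ⟨b, hb⟩ := hr u a
      exact ⟨b, by rw [hp, hp, hb, map_mul]⟩)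
  have hmem : ∀ x, x ∈ I ↔ x ∈ Set.range p := fun x => TwoSidedIdeal.mem_mk' _ _ _ _ _ _ x
  have : NeZero (d i) := ⟨hdi⟩
  rcases eq_bot_or_eq_top I with hI | hI
  · exfalso
    have h1 : p a₀ ∈ I := (hmem _).2 ⟨a₀, rfl⟩
    rw [hI] at h1
    exact hi h1
  · intro x
    exact (hmem x).1 (hI ▸ trivial)

/-- A nonzero idempotent finite dimensional algebra over an algebraically closed field has a full
matrix algebra as a quotient. -/
theorem exists_surjective_matrix [IsAlgClosed F] [FiniteDimensional F A]
    (hA : ∀ a : A, a ∈ Submodule.span F {x : A | ∃ b c, x = b * c}) (hne : ∃ a : A, a ≠ 0) :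
    ∃ n : ℕ, n ≠ 0 ∧ ∃ p : A →ₙₐ[F] Matrix (Fin n) (Fin n) F, Function.Surjective p := by
  have : FiniteDimensional F (Unitization F A) := by
    let L : F × A →ₗ[F] Unitization F A :=
      (Algebra.linearMap F (Unitization F A)).coprod (Unitization.inrHom F F A)
    refine Module.Finite.of_surjective L fun u => ⟨(u.fst, u.snd), ?_⟩
    ext <;> simp [L, Unitization.algebraMap_eq_inl]
  refine exists_surjective_matrix_of_ideal (Unitization.inrNonUnitalAlgHom F A)
    Unitization.inr_injective (fun u a => ⟨u.fst • a + u.snd * a, ?_⟩)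
    (fun u a => ⟨u.fst • a + a * u.snd, ?_⟩) hA hne <;> ext <;> simp

end MatrixQuotient

/-! ### Homogeneous components in the matrix quotient and their periods -/

section MatrixComponents

variable {F G A : Type*} [Field F] [CommGroup G] [Fintype G] [DecidableEq G]
  [NonUnitalRing A] [Module F A] [IsScalarTower F A A] [SMulCommClass F A A]
  {𝒜 : G → Submodule F A} {n : ℕ}

/-- A surjection of a graded simple algebra onto a matrix algebra is injective on the homogeneous
components. -/
lemma eq_zero_of_map_eq_zero (h : IsGrading 𝒜) (hs : IsGradedSimple 𝒜) (hn : n ≠ 0)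
    (p : A →ₙₐ[F] Matrix (Fin n) (Fin n) F) (hp : Function.Surjective p) {g : G} {x : A}
    (hx : x ∈ 𝒜 g) (h0 : p x = 0) : x = 0 := by
  have : NeZero n := ⟨hn⟩
  have h1 := hs.eq_bot_or_eq h (fun g => 𝒜 g ⊓ LinearMap.ker (p : A →ₗ[F] Matrix (Fin n) (Fin n) F))
    (fun g => inf_le_left)
    (fun g k a x ha hx => ⟨h.mul_mem ha hx.1, by
      have : p x = 0 := hx.2
      change p (a * x) = 0
      rw [map_mul, this, mul_zero]⟩)
    (fun g k a x ha hx => ⟨mul_comm k g ▸ h.mul_mem hx.1 ha, by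
      have : p x = 0 := hx.2
      change p (x * a) = 0
      rw [map_mul, this, zero_mul]⟩)
  rcases h1 with h1 | h1
  · have h2 : x ∈ 𝒜 g ⊓ LinearMap.ker (p : A →ₗ[F] Matrix (Fin n) (Fin n) F) := ⟨hx, h0⟩
    rw [h1] at h2
    exact h2
  · exfalso
    obtain ⟨a, ha⟩ := hp 1
    obtain ⟨f, hf, rfl⟩ := h.exists_sum_eq a
    rw [map_sum, sum_eq_zero] at ha
    · exact zero_ne_one ha
    · intro g _
      have := hf g
      rw [← h1 g] at this
      exact this.2

/-- A homogeneous element with nonzero scalar image in the matrix quotient is central and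
invertible. -/
theorem mem_center_and_isInvertible (h : IsGrading 𝒜) (hs : IsGradedSimple 𝒜) (hn : n ≠ 0)
    (p : A →ₙₐ[F] Matrix (Fin n) (Fin n) F) (hp : Function.Surjective p) {g : G} {v : A}
    (hv : v ∈ 𝒜 g) {c : F} (hc : c ≠ 0) (hpv : p v = Matrix.scalar (Fin n) c) :
    v ∈ Set.center A ∧ IsInvertible v := by
  have : NeZero n := ⟨hn⟩
  -- As `G` is abelian, the commutator of `v` with a homogeneous element is homogeneous; its image
  -- under `p` is zero, so it vanishes.
  have hcomm : ∀ a, a * v = v * a := by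
    intro a
    obtain ⟨f, hf, rfl⟩ := h.exists_sum_eq a
    rw [sum_mul, mul_sum]
    refine sum_congr rfl fun k _ => sub_eq_zero.1 ?_
    refine eq_zero_of_map_eq_zero h hs hn p hp (g := k * g) (Submodule.sub_mem _
      (h.mul_mem (hf k) hv) (mul_comm g k ▸ h.mul_mem hv (hf k))) ?_
    rw [map_sub, map_mul, map_mul, hpv, (Matrix.scalar_commute c (Commute.all c) (p (f k))).eq,
      sub_self]
  -- The homogeneous parts of `v A` form a stable family; it is not zero because `p` maps `v * a` to
  -- `c` when `p a = 1`.
  have hsurj : ∀ x, ∃ y, v * y = x := by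
    have h1 := hs.eq_bot_or_eq h (fun k => 𝒜 k ⊓ LinearMap.range (LinearMap.mulLeft F v))
      (fun g => inf_le_left)
      (fun g k a x ha hx => ⟨h.mul_mem ha hx.1, by
        obtain ⟨y, rfl⟩ := hx.2
        exact ⟨a * y, by simp only [LinearMap.mulLeft_apply, ← mul_assoc, hcomm]⟩⟩)
      (fun g k a x ha hx => ⟨mul_comm k g ▸ h.mul_mem hx.1 ha, by
        obtain ⟨y, rfl⟩ := hx.2
        exact ⟨y * a, by simp only [LinearMap.mulLeft_apply, ← mul_assoc]⟩⟩)
    rcases h1 with h1 | h1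
    · exfalso
      obtain ⟨a, ha⟩ := hp 1
      have h2 : v * a = 0 := by
        obtain ⟨f, hf, rfl⟩ := h.exists_sum_eq a
        rw [mul_sum]
        refine sum_eq_zero fun k _ => ?_
        have h3 : v * f k ∈ 𝒜 (g * k) ⊓ LinearMap.range (LinearMap.mulLeft F v) :=
          ⟨h.mul_mem hv (hf k), f k, rfl⟩
        rw [h1] at h3
        exact h3
      have h4 := congrArg p h2
      rw [map_mul, ha, mul_one, hpv, map_zero] at h4
      have h5 := congrFun (congrFun h4 0) 0
      simp at h5
      exact hc h5
    · intro x
      obtain ⟨f, hf, rfl⟩ := h.exists_sum_eq x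
      have h2 : ∀ k, ∃ y, v * y = f k := by
        intro k
        have := hf k
        rw [← h1 k] at this
        exact this.2
      choose y hy using h2
      exact ⟨∑ k, y k, by rw [mul_sum]; exact sum_congr rfl fun k _ => hy k⟩
  refine ⟨Semigroup.mem_center_iff.2 hcomm, ?_⟩
  obtain ⟨e, he⟩ := hsurj v
  have he' : ∀ a : A, e * a = a ∧ a * e = a := by
    intro a
    obtain ⟨b, rfl⟩ := hsurj a
    constructor
    · rw [← mul_assoc, hcomm e, he]
    · rw [← hcomm b, mul_assoc, he]
  obtain ⟨w, hw⟩ := hsurj e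
  exact ⟨e, he', w, hw, by rw [hcomm, hw]⟩

/-- The image of a homogeneous component in the matrix quotient. -/
def matComponent (𝒜 : G → Submodule F A) (p : A →ₙₐ[F] Matrix (Fin n) (Fin n) F) (g : G) :
    Submodule F (Matrix (Fin n) (Fin n) F) :=
  (𝒜 g).map (p : A →ₗ[F] Matrix (Fin n) (Fin n) F)

lemma mem_matComponent {p : A →ₙₐ[F] Matrix (Fin n) (Fin n) F} {g : G}
    {v : Matrix (Fin n) (Fin n) F} : v ∈ matComponent 𝒜 p g ↔ ∃ x ∈ 𝒜 g, p x = v := Iff.rfl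

lemma mul_mem_matComponent (h : IsGrading 𝒜) {p : A →ₙₐ[F] Matrix (Fin n) (Fin n) F} {g k : G}
    {v w : Matrix (Fin n) (Fin n) F} (hv : v ∈ matComponent 𝒜 p g) (hw : w ∈ matComponent 𝒜 p k) :
    v * w ∈ matComponent 𝒜 p (g * k) := by
  obtain ⟨x, hx, rfl⟩ := hv
  obtain ⟨y, hy, rfl⟩ := hw
  exact ⟨x * y, h.mul_mem hx hy, map_mul p x y⟩

/-- The periods of the family of images of the homogeneous components. -/
def periodSubgroup (𝒜 : G → Submodule F A) (p : A →ₙₐ[F] Matrix (Fin n) (Fin n) F) :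
    Subgroup G where
  carrier := {k | ∀ g, matComponent 𝒜 p (g * k) = matComponent 𝒜 p g}
  one_mem' g := by rw [mul_one]
  mul_mem' {a b} ha hb g := by rw [← mul_assoc, hb, ha]
  inv_mem' {a} ha g := by rw [← ha (g * a⁻¹), inv_mul_cancel_right]

lemma matComponent_mul {p : A →ₙₐ[F] Matrix (Fin n) (Fin n) F} {k : G}
    (hk : k ∈ periodSubgroup 𝒜 p) (g : G) :
    matComponent 𝒜 p (g * k) = matComponent 𝒜 p g := hk g

/-- Since `k` has finite order, the ascending chain of components returns to its start and all
inclusions are equalities. -/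
lemma mem_periodSubgroup_of_le {p : A →ₙₐ[F] Matrix (Fin n) (Fin n) F} {k : G}
    (hk : ∀ g, matComponent 𝒜 p g ≤ matComponent 𝒜 p (g * k)) : k ∈ periodSubgroup 𝒜 p := by
  intro g
  refine le_antisymm ?_ (hk g)
  have h1 : ∀ i : ℕ, matComponent 𝒜 p (g * k) ≤ matComponent 𝒜 p (g * k ^ (i + 1)) := by
    intro i
    induction i with
    | zero => simp
    | succ i ih =>
      refine ih.trans ((hk _).trans_eq ?_)
      rw [mul_assoc, ← pow_succ]
  have h2 := h1 (orderOf k - 1)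
  rwa [Nat.sub_add_cancel (orderOf_pos k), pow_orderOf_eq_one, mul_one] at h2

/-- The subspace of those elements of degree `g` whose image lies in the sum of the components of
degrees `g * d₀⁻¹ * d` for `d ∈ D`. -/
def relationSpace (𝒜 : G → Submodule F A) (p : A →ₙₐ[F] Matrix (Fin n) (Fin n) F) (D : Finset G)
    (d₀ g : G) : Submodule F A where
  carrier := {y | y ∈ 𝒜 g ∧ ∃ v : G → Matrix (Fin n) (Fin n) F,
    (∀ d ∈ D, v d ∈ matComponent 𝒜 p (g * d₀⁻¹ * d)) ∧ p y = ∑ d ∈ D, v d}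
  zero_mem' := ⟨Submodule.zero_mem _, 0, fun _ _ => Submodule.zero_mem _, by simp⟩
  add_mem' := by
    rintro x y ⟨hx, v, hv, hvx⟩ ⟨hy, w, hw, hwy⟩
    exact ⟨Submodule.add_mem _ hx hy, v + w, fun d hd => Submodule.add_mem _ (hv d hd) (hw d hd),
      by simp [hvx, hwy, sum_add_distrib]⟩
  smul_mem' := by
    rintro c x ⟨hx, v, hv, hvx⟩
    exact ⟨Submodule.smul_mem _ _ hx, c • v, fun d hd => Submodule.smul_mem _ _ (hv d hd),
      by simp [hvx, smul_sum]⟩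

/-- If all components lie in sums of translated components, uniquely, then one of the translations
is a period. -/
lemma exists_mem_periodSubgroup (h : IsGrading 𝒜) (hn : n ≠ 0)
    (p : A →ₙₐ[F] Matrix (Fin n) (Fin n) F) (hp : Function.Surjective p) (D : Finset G) (d₀ : G)
    (hD : ∀ (k : G) (v : G → Matrix (Fin n) (Fin n) F),
      (∀ d ∈ D, v d ∈ matComponent 𝒜 p (k * d)) → ∑ d ∈ D, v d = 0 → ∀ d ∈ D, v d = 0)
    (hall : ∀ g, relationSpace 𝒜 p D d₀ g = 𝒜 g) : ∃ d ∈ D, d₀⁻¹ * d ∈ periodSubgroup 𝒜 p := by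
  have : NeZero n := ⟨hn⟩
  have h1 : ∀ g y, y ∈ 𝒜 g → ∃ v : G → Matrix (Fin n) (Fin n) F,
      (∀ d ∈ D, v d ∈ matComponent 𝒜 p (g * d₀⁻¹ * d)) ∧ p y = ∑ d ∈ D, v d := by
    intro g y hy
    rw [← hall] at hy
    exact hy.2
  -- `θ g y d` is the part of `p y` in the component translated by `d₀⁻¹ * d`. By `hD` it is unique,
  -- hence compatible with multiplication by homogeneous elements on both sides.
  choose! θ hθ hθs using h1
  have huniq : ∀ g y, y ∈ 𝒜 g → ∀ v : G → Matrix (Fin n) (Fin n) F,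
      (∀ d ∈ D, v d ∈ matComponent 𝒜 p (g * d₀⁻¹ * d)) → p y = ∑ d ∈ D, v d →
      ∀ d ∈ D, θ g y d = v d := by
    intro g y hy v hv hvs d hd
    refine sub_eq_zero.1 (hD (g * d₀⁻¹) (fun d => θ g y d - v d)
      (fun d hd => Submodule.sub_mem _ (hθ g y hy d hd) (hv d hd)) ?_ d hd)
    rw [sum_sub_distrib, ← hθs g y hy, ← hvs, sub_self]
  have hleft : ∀ g k a y, a ∈ 𝒜 g → y ∈ 𝒜 k → ∀ d ∈ D, θ (g * k) (a * y) d = p a * θ k y d := by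
    intro g k a y ha hy
    refine huniq _ _ (h.mul_mem ha hy) _ (fun d hd => ?_) ?_
    · have := mul_mem_matComponent h (mem_matComponent.2 ⟨a, ha, rfl⟩) (hθ k y hy d hd)
      rwa [← mul_assoc, ← mul_assoc] at this
    · rw [map_mul, hθs k y hy, mul_sum]
  have hright : ∀ g k a y, a ∈ 𝒜 g → y ∈ 𝒜 k → ∀ d ∈ D, θ (g * k) (a * y) d = θ g a d * p y := by
    intro g k a y ha hy
    refine huniq _ _ (h.mul_mem ha hy) _ (fun d hd => ?_) ?_
    · have := mul_mem_matComponent h (hθ g a ha d hd) (mem_matComponent.2 ⟨y, hy, rfl⟩)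
      rwa [mul_comm, ← mul_assoc, ← mul_assoc, mul_comm k] at this
    · rw [map_mul, hθs g a ha, sum_mul]
  obtain ⟨a, ha⟩ := hp 1
  obtain ⟨f, hf, rfl⟩ := h.exists_sum_eq a
  rw [map_sum] at ha
  -- `z d` plays the role of `θ` at the identity: taking the part at `d` is multiplication by `z d`
  -- on either side. So `z d` is central, hence scalar, and where it is nonzero each component lies
  -- in its translate.
  let z : G → Matrix (Fin n) (Fin n) F := fun d => ∑ k, θ k (f k) d
  have hz1 : ∀ g y, y ∈ 𝒜 g → ∀ d ∈ D, θ g y d = z d * p y := by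
    intro g y hy d hd
    calc θ g y d = (∑ k, p (f k)) * θ g y d := by rw [ha, one_mul]
      _ = ∑ k, θ (k * g) (f k * y) d := by
        rw [sum_mul]; exact sum_congr rfl fun k _ => (hleft k g _ _ (hf k) hy d hd).symm
      _ = z d * p y := by
        rw [sum_mul]; exact sum_congr rfl fun k _ => hright k g _ _ (hf k) hy d hd
  have hz2 : ∀ g y, y ∈ 𝒜 g → ∀ d ∈ D, θ g y d = p y * z d := by
    intro g y hy d hd
    calc θ g y d = θ g y d * (∑ k, p (f k)) := by rw [ha, mul_one]
      _ = ∑ k, θ (g * k) (y * f k) d := by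
        rw [mul_sum]; exact sum_congr rfl fun k _ => (hright g k _ _ hy (hf k) d hd).symm
      _ = p y * z d := by
        rw [mul_sum]; exact sum_congr rfl fun k _ => hleft g k _ _ hy (hf k) d hd
  have hscal : ∀ d ∈ D, ∃ c : F, Matrix.scalar (Fin n) c = z d := by
    intro d hd
    refine Matrix.mem_range_scalar_of_commute_single fun i j _ => ?_
    obtain ⟨y, hy⟩ := hp (Matrix.single i j 1)
    rw [← hy]
    obtain ⟨f', hf', rfl⟩ := h.exists_sum_eq y
    rw [map_sum]
    refine Commute.sum_left _ _ _ fun k _ => ?_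
    exact (hz2 k _ (hf' k) d hd).symm.trans (hz1 k _ (hf' k) d hd)
  obtain ⟨d, hd, hne⟩ : ∃ d ∈ D, z d ≠ 0 := by
    by_contra! hcon
    have h2 : ∀ k, p (f k) = 0 := by
      intro k
      rw [hθs k _ (hf k)]
      exact sum_eq_zero fun d hd => by rw [hz1 k _ (hf k) d hd, hcon d hd, zero_mul]
    simp only [h2, sum_const_zero] at ha
    exact zero_ne_one ha
  obtain ⟨c, hc⟩ := hscal d hd
  have hc0 : c ≠ 0 := by
    rintro rfl
    exact hne (by rw [← hc, map_zero])
  refine ⟨d, hd, mem_periodSubgroup_of_le fun g v hv => ?_⟩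
  obtain ⟨y, hy, rfl⟩ := mem_matComponent.1 hv
  have h3 := hz1 g y hy d hd
  have h4 : p y = c⁻¹ • θ g y d := by
    rw [h3, ← hc, Matrix.scalar_apply, ← Matrix.smul_eq_diagonal_mul, smul_smul,
      inv_mul_cancel₀ hc0, one_smul]
  rw [h4, ← mul_assoc]
  exact Submodule.smul_mem _ _ (hθ g y hy d hd)

/-- Components whose degrees are distinct modulo the periods are independent. -/
theorem matComponent_independent (h : IsGrading 𝒜) (hs : IsGradedSimple 𝒜) (hn : n ≠ 0)
    (p : A →ₙₐ[F] Matrix (Fin n) (Fin n) F) (hp : Function.Surjective p) (D : Finset G)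
    (hD : ∀ d ∈ D, ∀ d' ∈ D, d⁻¹ * d' ∈ periodSubgroup 𝒜 p → d = d') (k : G)
    (v : G → Matrix (Fin n) (Fin n) F) (hv : ∀ d ∈ D, v d ∈ matComponent 𝒜 p (k * d))
    (hsum : ∑ d ∈ D, v d = 0) : ∀ d ∈ D, v d = 0 := by
  induction D using Finset.induction generalizing k v with
  | empty => simp
  | insert d₀ D hd₀ ih =>
    have ih' := ih fun d hd d' hd' => hD d (mem_insert_of_mem hd) d' (mem_insert_of_mem hd')
    -- The relation spaces are a stable family. If they vanish, the term at `d₀` is zero and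
    -- induction applies; if they are everything, some `d₀⁻¹ * d` is a period, against `hD`.
    have h1 := hs.eq_bot_or_eq h (relationSpace 𝒜 p D d₀) (fun g y hy => hy.1)
      (fun g k a y ha hy => by
        obtain ⟨hy, w, hw, hwy⟩ := hy
        refine ⟨h.mul_mem ha hy, fun d => p a * w d, fun d hd => ?_, ?_⟩
        · have := mul_mem_matComponent h (mem_matComponent.2 ⟨a, ha, rfl⟩) (hw d hd)
          rwa [← mul_assoc, ← mul_assoc] at this
        · rw [map_mul, hwy, mul_sum])
      (fun g k a y ha hy => by
        obtain ⟨hy, w, hw, hwy⟩ := hy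
        refine ⟨mul_comm k g ▸ h.mul_mem hy ha, fun d => w d * p a, fun d hd => ?_, ?_⟩
        · have := mul_mem_matComponent h (hw d hd) (mem_matComponent.2 ⟨a, ha, rfl⟩)
          rwa [mul_comm, ← mul_assoc, ← mul_assoc] at this
        · rw [map_mul, hwy, sum_mul])
    rcases h1 with h1 | h1
    · rw [sum_insert hd₀] at hsum
      have h0 : v d₀ = 0 := by
        obtain ⟨y, hy, hyv⟩ := mem_matComponent.1 (hv d₀ (mem_insert_self _ _))
        have h2 : y ∈ relationSpace 𝒜 p D d₀ (k * d₀) := by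
          refine ⟨hy, fun d => - v d, fun d hd => ?_, ?_⟩
          · rw [mul_inv_cancel_right]
            exact Submodule.neg_mem _ (hv d (mem_insert_of_mem hd))
          · rw [hyv, sum_neg_distrib, eq_neg_iff_add_eq_zero, hsum]
        rw [h1, Submodule.mem_bot] at h2
        rw [← hyv, h2, map_zero]
      rw [h0, zero_add] at hsum
      intro d hd
      rcases mem_insert.1 hd with rfl | hd
      · exact h0
      · exact ih' k v (fun d hd => hv d (mem_insert_of_mem hd)) hsum d hd
    · exfalso
      obtain ⟨d, hd, hper⟩ := exists_mem_periodSubgroup h hn p hp D d₀ ih' h1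
      exact hd₀ (hD d₀ (mem_insert_self _ _) d (mem_insert_of_mem hd) hper ▸ hd)

end MatrixComponents

/-! ### Monomials and multilinear polynomials -/

section Monomials

variable {F G : Type*} [Field F]
variable {B : Type*} [NonUnitalRing B] [Module F B] [IsScalarTower F B B] [SMulCommClass F B B]

/-- The monomial of a word; the empty word gives `0`. -/
noncomputable def monomial (F : Type*) {G : Type*} [Field F] : List (Var G) → GradedPoly F G
  | [] => 0
  | a :: l => MonoidAlgebra.single ⟨a, l⟩ 1

lemma eval_single (ρ : Var G → B) (w : FreeSemigroup (Var G)) :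
    eval (F := F) ρ (MonoidAlgebra.single w 1) = FreeSemigroup.lift ρ w := by
  simp [eval]

lemma mk_cons_eq {α : Type*} (a b : α) (l : List α) :
    (⟨a, b :: l⟩ : FreeSemigroup α) = FreeSemigroup.of a * ⟨b, l⟩ := rfl

lemma map_eval_monomial {C : Type*} [Ring C] [Algebra F C] (q : B →ₙₐ[F] C) (ρ : Var G → B)
    {l : List (Var G)} (hl : l ≠ []) :
    q (eval ρ (monomial F l)) = (l.map (q ∘ ρ)).prod := by
  obtain ⟨a, l, rfl⟩ := List.exists_cons_of_ne_nil hl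
  clear hl
  rw [monomial, eval_single]
  induction l generalizing a with
  | nil =>
    rw [show (⟨a, []⟩ : FreeSemigroup (Var G)) = FreeSemigroup.of a from rfl]
    simp
  | cons b l ih => rw [mk_cons_eq, map_mul, map_mul, ih b]; simp

lemma rename_monomial (σ : Equiv.Perm (Var G)) (l : List (Var G)) :
    rename σ (monomial F l) = monomial F (l.map σ) := by
  cases l with
  | nil => simp [monomial]
  | cons a l =>
    simp only [monomial, rename, eval_single, List.map_cons]
    induction l generalizing a with
    | nil =>
      rw [show (⟨a, []⟩ : FreeSemigroup (Var G)) = FreeSemigroup.of a from rfl]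
      simp only [FreeSemigroup.lift_of]
      rfl
    | cons b l ih =>
      rw [mk_cons_eq, map_mul, ih b, FreeSemigroup.lift_of, var, MonoidAlgebra.single_mul_single,
        one_mul]
      rfl

lemma isMultilinear_monomial {V : Finset (Var G)} {l : List (Var G)}
    (hl : (l : Multiset (Var G)) = V.val) : IsMultilinear V (monomial F l) := by
  cases l with
  | nil => exact Submodule.zero_mem _
  | cons a l => exact Submodule.subset_span ⟨⟨a, l⟩, hl, rfl⟩

lemma IsMultilinear.induction {V : Finset (Var G)} {P : GradedPoly F G → Prop} {f : GradedPoly F G}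
    (hf : IsMultilinear V f)
    (hmon : ∀ l : List (Var G), l ≠ [] → (l : Multiset (Var G)) = V.val → P (monomial F l))
    (h0 : P 0) (hadd : ∀ f g, P f → P g → P (f + g)) (hsmul : ∀ (c : F) f, P f → P (c • f)) :
    P f := by
  induction hf using Submodule.span_induction with
  | mem x hx =>
    obtain ⟨w, hw, rfl⟩ := hx
    exact hmon (w.head :: w.tail) (by simp) hw
  | zero => exact h0
  | add x y _ _ hx hy => exact hadd x y hx hy
  | smul c x _ hx => exact hsmul c x hx

lemma monomial_mul_monomial {l l' : List (Var G)} (hl : l ≠ []) (hl' : l' ≠ []) :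
    monomial F l * monomial F l' = monomial F (l ++ l') := by
  obtain ⟨a, l, rfl⟩ := List.exists_cons_of_ne_nil hl
  obtain ⟨b, l', rfl⟩ := List.exists_cons_of_ne_nil hl'
  simp only [monomial, MonoidAlgebra.single_mul_single, one_mul, List.cons_append]
  rfl

lemma IsMultilinear.mul [DecidableEq G] {V W : Finset (Var G)} {f g : GradedPoly F G}
    (hf : IsMultilinear V f) (hg : IsMultilinear W g) (hVW : Disjoint V W) :
    IsMultilinear (V ∪ W) (f * g) := by
  refine hf.induction (P := fun f => IsMultilinear (V ∪ W) (f * g)) (fun l hl hlV => ?_)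
    (by rw [zero_mul]; exact Submodule.zero_mem _)
    (fun f g hf hg => by rw [add_mul]; exact Submodule.add_mem _ hf hg)
    (fun c f hf => by rw [smul_mul_assoc]; exact Submodule.smul_mem _ _ hf)
  refine hg.induction (P := fun g => IsMultilinear (V ∪ W) (monomial F l * g))
    (fun l' hl' hlW => ?_) (by rw [mul_zero]; exact Submodule.zero_mem _)
    (fun f g hf hg => by rw [mul_add]; exact Submodule.add_mem _ hf hg)
    (fun c f hf => by rw [mul_smul_comm]; exact Submodule.smul_mem _ _ hf)
  rw [monomial_mul_monomial hl hl']
  refine isMultilinear_monomial ?_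
  rw [← Multiset.coe_add, hlV, hlW, ← Finset.disjUnion_eq_union V W hVW]
  rfl

lemma IsMultilinear.rename_eq_self {W : Finset (Var G)} {g : GradedPoly F G}
    (hg : IsMultilinear W g) {σ : Equiv.Perm (Var G)} (hσ : ∀ x ∈ W, σ x = x) :
    rename σ g = g := by
  refine hg.induction (P := fun g => rename σ g = g) (fun l hl hlW => ?_) (map_zero _)
    (fun f g hf hg => by rw [map_add, hf, hg]) (fun c f hf => by rw [map_smul, hf])
  rw [rename_monomial]
  congr 1
  exact (List.map_congr_left (g := id) fun x hx =>
    hσ x (by rw [← Finset.mem_val, ← hlW]; exact hx)).trans (List.map_id l)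

/-- All monomials contain the same variables, so over an abelian group they have the same degree. -/
lemma eval_mem_of_isMultilinear {A : Type*} [NonUnitalRing A] [Module F A] [IsScalarTower F A A]
    [SMulCommClass F A A] [CommGroup G] [DecidableEq G] {𝒜 : G → Submodule F A}
    (h : IsGrading 𝒜) {ρ : Var G → A}
    (hρ : IsGradedSubst 𝒜 ρ) {V : Finset (Var G)} {f : GradedPoly F G} (hf : IsMultilinear V f) :
    eval ρ f ∈ 𝒜 (∏ x ∈ V, x.1) := by
  refine hf.induction (P := fun f => eval ρ f ∈ 𝒜 (∏ x ∈ V, x.1)) (fun l hl hlV => ?_)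
    (by rw [map_zero]; exact Submodule.zero_mem _)
    (fun f g hf hg => by rw [map_add]; exact Submodule.add_mem _ hf hg)
    (fun c f hf => by rw [map_smul]; exact Submodule.smul_mem _ _ hf)
  have h1 : ∏ x ∈ V, x.1 = (l.map Prod.fst).prod := by
    rw [Finset.prod, ← hlV, Multiset.map_coe, Multiset.prod_coe]
  rw [h1]
  obtain ⟨a, l, rfl⟩ := List.exists_cons_of_ne_nil hl
  clear hlV h1 hl
  rw [monomial, eval_single]
  induction l generalizing a with
  | nil =>
    rw [show (⟨a, []⟩ : FreeSemigroup (Var G)) = FreeSemigroup.of a from rfl]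
    simpa using hρ a
  | cons b l ih =>
    rw [mk_cons_eq, map_mul, FreeSemigroup.lift_of, List.map_cons, List.prod_cons]
    exact h.mul_mem (hρ a) (ih b)

end Monomials

/-! ### The doubly alternating polynomial of a word -/

section RegevPolynomial

variable {F G : Type*} [Field F] {ι : Type*} [Fintype ι] [DecidableEq ι]

/-- The alternating sum of the monomials of a word in two sets of variables. -/
noncomputable def regevPoly (F : Type*) [Field F] (word : List (ι ⊕ ι)) (vx vy : ι → Var G) :
    GradedPoly F G :=
  ∑ σ : Equiv.Perm ι, ∑ τ : Equiv.Perm ι,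
    ((Equiv.Perm.sign σ : ℤ) * (Equiv.Perm.sign τ : ℤ)) •
      monomial F (word.map (Sum.elim (vx ∘ σ) (vy ∘ τ)))

variable {word : List (ι ⊕ ι)}

lemma isMultilinear_regevPoly [DecidableEq G] (hword : (word : Multiset (ι ⊕ ι)) = univ.val)
    {vx vy : ι → Var G} (hinj : Function.Injective (Sum.elim vx vy)) :
    IsMultilinear (univ.image (Sum.elim vx vy)) (regevPoly F word vx vy) := by
  refine Submodule.sum_mem _ fun σ _ => Submodule.sum_mem _ fun τ _ => ?_
  refine zsmul_mem ?_ _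
  refine isMultilinear_monomial ?_
  have h1 : (Sum.elim (vx ∘ σ) (vy ∘ τ) : ι ⊕ ι → Var G) =
      Sum.elim vx vy ∘ (Equiv.sumCongr σ τ) := by
    ext1 (i | i) <;> rfl
  rw [← Multiset.map_coe, hword, h1, ← Multiset.map_map,
    Finset.image_val_of_injOn hinj.injOn]
  congr 1
  have := congrArg Finset.val (Finset.map_univ_equiv (Equiv.sumCongr σ τ))
  rwa [Finset.map_val] at this

lemma map_eval_regevPoly {A C : Type*} [NonUnitalRing A] [Module F A] [IsScalarTower F A A]
    [SMulCommClass F A A] [Ring C] [Algebra F C] (q : A →ₙₐ[F] C) (ρ : Var G → A)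
    (hword : word ≠ []) (vx vy : ι → Var G) :
    q (eval ρ (regevPoly F word vx vy)) = regevSum word (q ∘ ρ ∘ vx) (q ∘ ρ ∘ vy) := by
  simp only [regevPoly, map_sum, map_zsmul, regevSum]
  refine sum_congr rfl fun σ _ => sum_congr rfl fun τ _ => ?_
  rw [map_eval_monomial q ρ (by simpa using hword), List.map_map]
  congr 3
  ext1 (i | i) <;> rfl

lemma rename_regevPoly (κ : Equiv.Perm (Var G)) (vx vy : ι → Var G) :
    rename κ (regevPoly F word vx vy) = regevPoly F word (κ ∘ vx) (κ ∘ vy) := by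
  simp only [regevPoly, map_sum, map_zsmul]
  refine sum_congr rfl fun σ _ => sum_congr rfl fun τ _ => ?_
  rw [rename_monomial, List.map_map]
  congr 3
  ext1 (i | i) <;> rfl

lemma regevPoly_comp_left (π : Equiv.Perm ι) (vx vy : ι → Var G) :
    regevPoly F word (vx ∘ π) vy = (Equiv.Perm.sign π : ℤ) • regevPoly F word vx vy := by
  simp only [regevPoly, smul_sum]
  rw [← Equiv.sum_comp (Equiv.mulLeft π) (fun σ => ∑ τ : Equiv.Perm ι,
    (Equiv.Perm.sign π : ℤ) • ((Equiv.Perm.sign σ : ℤ) * (Equiv.Perm.sign τ : ℤ)) •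
      monomial F (word.map (Sum.elim (vx ∘ σ) (vy ∘ τ))))]
  refine sum_congr rfl fun σ _ => sum_congr rfl fun τ _ => ?_
  rw [smul_smul]
  have : (Equiv.Perm.sign π : ℤ) * (Equiv.Perm.sign π : ℤ) = 1 := Int.units_coe_mul_self _
  have h2 : (Equiv.Perm.sign π : ℤ) * ((Equiv.Perm.sign (Equiv.mulLeft π σ) : ℤ) *
      (Equiv.Perm.sign τ : ℤ)) = (Equiv.Perm.sign σ : ℤ) * (Equiv.Perm.sign τ : ℤ) := by
    rw [Equiv.coe_mulLeft, Equiv.Perm.sign_mul]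
    push_cast
    linear_combination ((Equiv.Perm.sign σ : ℤ) * (Equiv.Perm.sign τ : ℤ)) * this
  rw [h2]
  rfl

lemma regevPoly_comp_right (π : Equiv.Perm ι) (vx vy : ι → Var G) :
    regevPoly F word vx (vy ∘ π) = (Equiv.Perm.sign π : ℤ) • regevPoly F word vx vy := by
  simp only [regevPoly, smul_sum]
  refine sum_congr rfl fun σ _ => ?_
  rw [← Equiv.sum_comp (Equiv.mulLeft π) (fun τ =>
    (Equiv.Perm.sign π : ℤ) • ((Equiv.Perm.sign σ : ℤ) * (Equiv.Perm.sign τ : ℤ)) •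
      monomial F (word.map (Sum.elim (vx ∘ σ) (vy ∘ τ))))]
  refine sum_congr rfl fun τ _ => ?_
  rw [smul_smul]
  have : (Equiv.Perm.sign π : ℤ) * (Equiv.Perm.sign π : ℤ) = 1 := Int.units_coe_mul_self _
  have h2 : (Equiv.Perm.sign π : ℤ) * ((Equiv.Perm.sign σ : ℤ) *
      (Equiv.Perm.sign (Equiv.mulLeft π τ) : ℤ)) =
      (Equiv.Perm.sign σ : ℤ) * (Equiv.Perm.sign τ : ℤ) := by
    rw [Equiv.coe_mulLeft, Equiv.Perm.sign_mul]
    push_cast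
    linear_combination ((Equiv.Perm.sign σ : ℤ) * (Equiv.Perm.sign τ : ℤ)) * this
  rw [h2]
  rfl

/-- A permutation of a set of values of an injective family comes from a permutation of the indices
of the same sign. -/
lemma exists_perm_comp_eq {α : Type*} [DecidableEq α] {v : ι → α} (hv : Function.Injective v)
    {S : Finset α} (hS : ∀ x ∈ S, ∃ i, v i = x) (σ : Equiv.Perm S) :
    ∃ π : Equiv.Perm ι, Equiv.Perm.ofSubtype σ ∘ v = v ∘ π ∧
      Equiv.Perm.sign π = Equiv.Perm.sign σ := by
  choose u hu using fun x : S => hS x.1 x.2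
  let e : S ↪ ι := ⟨u, fun x y h => Subtype.ext (by rw [← hu x, ← hu y, h])⟩
  refine ⟨σ.viaFintypeEmbedding e, ?_, Equiv.Perm.viaFintypeEmbedding_sign ..⟩
  ext1 i
  by_cases hi : v i ∈ S
  · have h1 : e ⟨v i, hi⟩ = i := hv (hu ⟨v i, hi⟩)
    have h2 := Equiv.Perm.viaFintypeEmbedding_apply_image σ e ⟨v i, hi⟩
    rw [h1] at h2
    simp only [Function.comp_apply, h2]
    rw [Equiv.Perm.ofSubtype_apply_of_mem σ hi]
    exact (hu _).symm
  · have h1 : i ∉ Set.range e := by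
      rintro ⟨x, rfl⟩
      exact hi (by rw [show v (e x) = x from hu x]; exact x.2)
    simp only [Function.comp_apply]
    rw [Equiv.Perm.viaFintypeEmbedding_apply_notMem_range σ e h1,
      Equiv.Perm.ofSubtype_apply_of_not_mem σ hi]

lemma ofSubtype_comp_eq_self {α β : Type*} [DecidableEq α] {v : β → α} {S : Finset α}
    (hS : ∀ i, v i ∉ S) (σ : Equiv.Perm S) : Equiv.Perm.ofSubtype σ ∘ v = v :=
  funext fun i => Equiv.Perm.ofSubtype_apply_of_not_mem σ (hS i)

/-- Any subset `S` of the first set is allowed: a block mixes variables of several degrees, and each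
set of variables required in the theorem is only its part of one degree. -/
lemma isAlternating_regevPoly_left [DecidableEq G] {vx vy : ι → Var G}
    (hinj : Function.Injective (Sum.elim vx vy)) {S : Finset (Var G)}
    (hS : ∀ x ∈ S, ∃ i, vx i = x) : IsAlternating S (regevPoly F word vx vy) := by
  intro σ
  obtain ⟨π, hπ, hsign⟩ := exists_perm_comp_eq (hinj.comp Sum.inl_injective) hS σ
  have h2 : Equiv.Perm.ofSubtype σ ∘ vy = vy := ofSubtype_comp_eq_self (fun i hi => by
    obtain ⟨k, hk⟩ := hS _ hi
    exact absurd (hinj (a₁ := Sum.inl k) (a₂ := Sum.inr i) hk) (by simp)) σ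
  rw [rename_regevPoly, h2, show Equiv.Perm.ofSubtype σ ∘ vx = vx ∘ π from hπ,
    regevPoly_comp_left, hsign]

lemma isAlternating_regevPoly_right [DecidableEq G] {vx vy : ι → Var G}
    (hinj : Function.Injective (Sum.elim vx vy)) {S : Finset (Var G)}
    (hS : ∀ x ∈ S, ∃ i, vy i = x) : IsAlternating S (regevPoly F word vx vy) := by
  intro σ
  obtain ⟨π, hπ, hsign⟩ := exists_perm_comp_eq (hinj.comp Sum.inr_injective) hS σ
  have h2 : Equiv.Perm.ofSubtype σ ∘ vx = vx := ofSubtype_comp_eq_self (fun i hi => by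
    obtain ⟨k, hk⟩ := hS _ hi
    exact absurd (hinj (a₁ := Sum.inr k) (a₂ := Sum.inl i) hk) (by simp)) σ
  rw [rename_regevPoly, h2, show Equiv.Perm.ofSubtype σ ∘ vy = vy ∘ π from hπ,
    regevPoly_comp_right, hsign]

end RegevPolynomial

/-! ### Products of polynomials in disjoint variables -/

section Products

variable {F G A : Type*} [Field F] [DecidableEq G] [NonUnitalRing A] [Module F A]
  [IsScalarTower F A A] [SMulCommClass F A A] {n : ℕ}

lemma IsMultilinear.rename_ofSubtype_eq_self {W S : Finset (Var G)} {g : GradedPoly F G}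
    (hg : IsMultilinear W g) (hSW : Disjoint S W) (σ : Equiv.Perm S) :
    rename (Equiv.Perm.ofSubtype σ) g = g :=
  hg.rename_eq_self fun _ hx =>
    Equiv.Perm.ofSubtype_apply_of_not_mem σ (Finset.disjoint_right.1 hSW hx)

/-- A product of polynomials in disjoint sets of variables is alternating where the factors are. -/
lemma exists_product_of_blocks {B : Type*} [DecidableEq B] (V : B → Finset (Var G))
    (hV : ∀ b b', b ≠ b' → Disjoint (V b) (V b')) (f : B → GradedPoly F G)
    (hf : ∀ b, IsMultilinear (V b) (f b)) (p : A →ₙₐ[F] Matrix (Fin n) (Fin n) F) (ρ : Var G → A)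
    (hc : ∀ b, ∃ c : F, c ≠ 0 ∧ p (eval ρ (f b)) = Matrix.scalar (Fin n) c)
    (s : Finset B) (hs : s.Nonempty) :
    ∃ φ : GradedPoly F G, IsMultilinear (s.biUnion V) φ ∧
      (∀ b ∈ s, ∀ S ⊆ V b, IsAlternating S (f b) → IsAlternating S φ) ∧
      ∃ c : F, c ≠ 0 ∧ p (eval ρ φ) = Matrix.scalar (Fin n) c := by
  induction hs using Finset.Nonempty.cons_induction with
  | singleton b =>
    refine ⟨f b, by simpa using hf b, fun b' hb' S _ hS => ?_, hc b⟩
    rwa [mem_singleton.1 hb'] at hS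
  | cons b s hb hs ih =>
    obtain ⟨φ, hφ, halt, c, hc0, hcφ⟩ := ih
    obtain ⟨c', hc0', hcf⟩ := hc b
    have hdisj : Disjoint (V b) (s.biUnion V) := by
      rw [disjoint_biUnion_right]
      exact fun b' hb' => hV b b' fun h => hb (h ▸ hb')
    refine ⟨f b * φ, ?_, ?_, c' * c, mul_ne_zero hc0' hc0, ?_⟩
    · rw [cons_eq_insert, biUnion_insert]
      exact (hf b).mul hφ hdisj
    · intro b' hb' S hS hSalt σ
      rw [map_mul]
      rcases mem_cons.1 hb' with rfl | hb'
      · rw [hSalt σ, hφ.rename_ofSubtype_eq_self (hdisj.mono_left hS), smul_mul_assoc]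
      · rw [halt b' hb' S hS hSalt σ, (hf b).rename_ofSubtype_eq_self
          ((hV b' b fun h => hb (h ▸ hb')).mono_left hS), mul_smul_comm]
    · rw [map_mul, map_mul, hcf, hcφ, ← map_mul]

end Products

/-! ### A homogeneous basis of the matrix quotient -/

section HomogeneousBasis

variable {F G A : Type*} [Field F] [CommGroup G] [Fintype G] [DecidableEq G]
  [NonUnitalRing A] [Module F A] [IsScalarTower F A A] [SMulCommClass F A A]
  {𝒜 : G → Submodule F A} {n : ℕ}

lemma finrank_matComponent (h : IsGrading 𝒜) (hs : IsGradedSimple 𝒜) (hn : n ≠ 0)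
    (p : A →ₙₐ[F] Matrix (Fin n) (Fin n) F) (hp : Function.Surjective p) (g : G) :
    Module.finrank F (matComponent 𝒜 p g) = gDim 𝒜 g := by
  let L : 𝒜 g →ₗ[F] Matrix (Fin n) (Fin n) F :=
    (p : A →ₗ[F] Matrix (Fin n) (Fin n) F).comp (𝒜 g).subtype
  have hL : Function.Injective L := by
    refine (injective_iff_map_eq_zero L).2 fun x hx => Subtype.ext ?_
    exact eq_zero_of_map_eq_zero h hs hn p hp x.2 hx
  have h1 : LinearMap.range L = matComponent 𝒜 p g := by
    rw [LinearMap.range_comp, Submodule.range_subtype]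
    rfl
  rw [← h1, LinearMap.finrank_range_of_inj hL, gDim]

lemma matComponent_out (p : A →ₙₐ[F] Matrix (Fin n) (Fin n) F) (g : G) :
    matComponent 𝒜 p (g : G ⧸ periodSubgroup 𝒜 p).out = matComponent 𝒜 p g := by
  obtain ⟨k, hk⟩ := QuotientGroup.mk_out_eq_mul (periodSubgroup 𝒜 p) g
  rw [hk, matComponent_mul k.2]

open scoped Classical in
/-- The components at representatives of the cosets of the periods decompose the matrix algebra. -/
lemma isInternal_matComponent_out (h : IsGrading 𝒜) (hs : IsGradedSimple 𝒜) (hn : n ≠ 0)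
    (p : A →ₙₐ[F] Matrix (Fin n) (Fin n) F) (hp : Function.Surjective p) :
    DirectSum.IsInternal fun q : G ⧸ periodSubgroup 𝒜 p => matComponent 𝒜 p q.out := by
  refine DirectSum.isInternal_submodule_of_iSupIndep_of_iSup_eq_top ?_ ?_
  · rw [iSupIndep_iff_finsetSum_eq_zero_imp_eq_zero]
    intro s v hv hsum q hq
    have h1 := matComponent_independent h hs hn p hp (s.image Quotient.out)
      (fun d hd d' hd' hdd' => by
        obtain ⟨q, _, rfl⟩ := mem_image.1 hd
        obtain ⟨q', _, rfl⟩ := mem_image.1 hd'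
        have := QuotientGroup.eq.2 hdd'
        rw [QuotientGroup.out_eq', QuotientGroup.out_eq'] at this
        rw [this])
      1 (fun g => v (g : G ⧸ periodSubgroup 𝒜 p))
      (fun d hd => by
        obtain ⟨q, hq, rfl⟩ := mem_image.1 hd
        rw [QuotientGroup.out_eq', one_mul]
        exact hv q hq)
      (by
        rw [sum_image fun q _ q' _ hqq' => Quotient.out_injective hqq']
        refine (sum_congr rfl fun q _ => ?_).trans hsum
        rw [QuotientGroup.out_eq'])
      q.out (mem_image_of_mem _ hq)
    rwa [QuotientGroup.out_eq'] at h1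
  · rw [eq_top_iff]
    intro x _
    obtain ⟨a, rfl⟩ := hp x
    obtain ⟨f, hf, rfl⟩ := h.exists_sum_eq a
    rw [map_sum]
    refine Submodule.sum_mem _ fun g _ => ?_
    refine Submodule.mem_iSup_of_mem (g : G ⧸ periodSubgroup 𝒜 p) ?_
    rw [matComponent_out]
    exact mem_matComponent.2 ⟨f g, hf g, rfl⟩

/-- A basis of the matrix quotient consisting of images of homogeneous elements, such that the
translates of its degrees by the periods enumerate bases of all homogeneous components. -/
theorem exists_homogeneous_basis (h : IsGrading 𝒜) (hs : IsGradedSimple 𝒜) (hn : n ≠ 0)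
    (p : A →ₙₐ[F] Matrix (Fin n) (Fin n) F) (hp : Function.Surjective p) :
    ∃ (K : Subgroup G) (d : Fin n × Fin n → G) (l : Fin n × Fin n → ℕ)
      (b : Fin n × Fin n → Matrix (Fin n) (Fin n) F),
      LinearIndependent F b ∧ (∀ a (k : K), b a ∈ matComponent 𝒜 p (d a * k)) ∧
      (∀ a a' (k k' : K), d a * k = d a' * k' → k = k') ∧
      (∀ a a', d a = d a' → l a = l a' → a = a') ∧
      ∀ g m, m < gDim 𝒜 g ↔ ∃ a, ∃ k : K, d a * k = g ∧ l a = m := by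
  classical
  let K := periodSubgroup 𝒜 p
  let B := (isInternal_matComponent_out h hs hn p hp).collectedBasis
    fun q => Module.finBasis F (matComponent 𝒜 p q.out)
  -- The degree `d a` is the coset representative and `l a` the index within its component;
  -- translating by `K` reaches every pair `(g, m)` with `m < gDim 𝒜 g`.
  let ε : Fin n × Fin n ≃ Σ q : G ⧸ K, Fin (Module.finrank F (matComponent 𝒜 p q.out)) :=
    (Matrix.stdBasis F (Fin n) (Fin n)).indexEquiv B
  have hdim : ∀ g : G, Module.finrank F (matComponent 𝒜 p (g : G ⧸ K).out) = gDim 𝒜 g := by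
    intro g
    rw [matComponent_out, finrank_matComponent h hs hn p hp]
  have hmk : ∀ (q : G ⧸ K) (k : K), ((q.out * k : G) : G ⧸ K) = q := by
    intro q k
    rw [QuotientGroup.mk_mul_of_mem _ k.2, QuotientGroup.out_eq']
  refine ⟨K, fun a => (ε a).1.out, fun a => (ε a).2, B ∘ ε,
    B.linearIndependent.comp _ ε.injective, ?_, ?_, ?_, ?_⟩
  · intro a k
    rw [matComponent_mul k.2]
    simp only [B, Function.comp_apply, DirectSum.IsInternal.collectedBasis_coe]
    exact Subtype.mem _
  · intro a a' k k' hk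
    have h1 : (ε a).1 = (ε a').1 := by rw [← hmk (ε a).1 k, ← hmk (ε a').1 k', hk]
    simp only [h1] at hk
    exact Subtype.ext (mul_left_cancel hk)
  · intro a a' h1 h2
    refine ε.injective (Sigma.ext (Quotient.out_injective h1) ?_)
    rw [Fin.heq_ext_iff (by rw [Quotient.out_injective h1])]
    exact h2
  · intro g m
    constructor
    · intro hm
      rw [← hdim] at hm
      refine ⟨ε.symm ⟨(g : G ⧸ K), ⟨m, hm⟩⟩, ⟨(g : G ⧸ K).out⁻¹ * g, ?_⟩, ?_, ?_⟩
      · rw [← QuotientGroup.eq, QuotientGroup.out_eq']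
      · simp
      · have h1 : ∀ z, ((ε (ε.symm z)).2 : ℕ) = z.2 := fun z => by rw [ε.apply_symm_apply]
        exact h1 _
    · rintro ⟨a, k, rfl, rfl⟩
      rw [← hdim, hmk]
      exact (ε a).2.2

end HomogeneousBasis

/-! ### Assembly of the alternating polynomial -/

section DoubledPolynomial

variable {F G A : Type*} [Field F] [CharZero F] [CommGroup G] [Fintype G] [DecidableEq G]
  [NonUnitalRing A] [Module F A] [IsScalarTower F A A] [SMulCommClass F A A]
  {𝒜 : G → Submodule F A} {n : ℕ}

/-- The `j`-th set of `gDim 𝒜 g` variables of degree `g`. -/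
noncomputable def varSet (𝒜 : G → Submodule F A) (j : ℕ) (g : G) : Finset (Var G) :=
  (range (gDim 𝒜 g)).image fun m => (g, Nat.pair j m)

lemma mem_varSet {j : ℕ} {g : G} {x : Var G} :
    x ∈ varSet 𝒜 j g ↔ ∃ m < gDim 𝒜 g, (g, Nat.pair j m) = x := by
  simp [varSet]

/-- For each `i < t` and `k ∈ K` one block uses the copies `2 * i` and `2 * i + 1` of the variables
of degrees `d a * k`. All blocks specialize to the same basis `b`, and `φ` is their product. -/
theorem exists_isFoldAlternating_eval_eq_scalar (h : IsGrading 𝒜) (hs : IsGradedSimple 𝒜)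
    (hn : n ≠ 0) (p : A →ₙₐ[F] Matrix (Fin n) (Fin n) F) (hp : Function.Surjective p) (t : ℕ)
    (ht : 1 ≤ t) : ∃ φ : GradedPoly F G,
      IsFoldAlternating (2 * t) (gDim 𝒜) (fun j => varSet 𝒜 j) ∅ φ ∧
      ∃ ρ : Var G → A, IsGradedSubst 𝒜 ρ ∧
        ∃ c : F, c ≠ 0 ∧ p (eval ρ φ) = Matrix.scalar (Fin n) c := by
  classical
  have : NeZero n := ⟨hn⟩
  have : NeZero t := ⟨by omega⟩
  obtain ⟨K, d, l, b, hb, hbm, hdK, hdl, hdim⟩ := exists_homogeneous_basis h hs hn p hp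
  obtain ⟨word, hword, hreg⟩ := exists_word_regevSum_eq_scalar F hn
  obtain ⟨c, hc, hcb⟩ := hreg b hb
  have hne : word ≠ [] := by
    rintro rfl
    have h1 : (Sum.inl (0, 0) : Fin n × Fin n ⊕ Fin n × Fin n) ∈ univ.val := mem_univ _
    rw [← hword] at h1
    simp at h1
  have hinj : ∀ {a a'} {k k' : K}, d a * k = d a' * k' → l a = l a' → a = a' ∧ k = k' := by
    intro a a' k k' h1 h2
    obtain rfl := hdK _ _ _ _ h1
    exact ⟨hdl _ _ (mul_right_cancel h1) h2, rfl⟩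
  -- A variable that encodes the pair of degree `d a * k` and index `l a` goes to the lift of `b a`
  -- in that degree; all other variables may go to `0`.
  have hlift : ∀ x : Var G, ∃ y ∈ 𝒜 x.1, ∀ a (k : K), d a * k = x.1 → l a = (Nat.unpair x.2).2 →
      p y = b a := by
    intro x
    by_cases hx : ∃ a, ∃ k : K, d a * k = x.1 ∧ l a = (Nat.unpair x.2).2
    · obtain ⟨a, k, h1, h2⟩ := hx
      obtain ⟨y, hy, hyb⟩ := mem_matComponent.1 (hbm a k)
      refine ⟨y, h1 ▸ hy, fun a' k' h1' h2' => ?_⟩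
      rw [(hinj (h1'.trans h1.symm) (h2'.trans h2.symm)).1, hyb]
    · exact ⟨0, Submodule.zero_mem _, fun a k h1 h2 => absurd ⟨a, k, h1, h2⟩ hx⟩
  choose ρ hρ hρb using hlift
  let v : ℕ → K → Fin n × Fin n → Var G := fun j k a => (d a * k, Nat.pair j (l a))
  have hv : ∀ {j j' k k' a a'}, v j k a = v j' k' a' → j = j' ∧ k = k' ∧ a = a' := by
    intro j j' k k' a a' h1
    obtain ⟨h2, h3⟩ := Prod.mk.inj h1
    obtain ⟨h3, h4⟩ := Nat.pair_eq_pair.1 h3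
    exact ⟨h3, (hinj h2 h4).2, (hinj h2 h4).1⟩
  have hpv : ∀ j k, p ∘ ρ ∘ v j k = b := fun j k => funext fun a =>
    hρb _ a k rfl (by simp only [v, Nat.unpair_pair])
  let e : Fin t × K → Fin n × Fin n ⊕ Fin n × Fin n → Var G := fun i =>
    Sum.elim (v (2 * i.1) i.2) (v (2 * i.1 + 1) i.2)
  have he : ∀ {i i' z z'}, e i z = e i' z' → i = i' ∧ z = z' := by
    rintro ⟨i, k⟩ ⟨i', k'⟩ (a | a) (a' | a') h1 <;>
    obtain ⟨h2, rfl, rfl⟩ := hv h1 <;> dsimp only at h2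
    · exact ⟨Prod.ext (Fin.ext (by dsimp only; omega)) rfl, rfl⟩
    · omega
    · omega
    · exact ⟨Prod.ext (Fin.ext (by dsimp only; omega)) rfl, rfl⟩
  have heinj : ∀ i, Function.Injective (e i) := fun i z z' hz => (he hz).2
  obtain ⟨φ, hφ, halt, c', hc', hcφ⟩ := exists_product_of_blocks (fun i => univ.image (e i))
    (fun i i' hi => by
      refine Finset.disjoint_left.2 fun x hx hx' => ?_
      obtain ⟨z, _, rfl⟩ := mem_image.1 hx
      obtain ⟨z', _, hz⟩ := mem_image.1 hx'
      exact hi (he hz).1.symm)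
    (fun i => regevPoly F word (v (2 * i.1) i.2) (v (2 * i.1 + 1) i.2))
    (fun i => isMultilinear_regevPoly hword (heinj i)) p ρ
    (fun i => ⟨c, hc, by rw [map_eval_regevPoly p ρ hne, hpv, hpv, hcb]⟩) univ univ_nonempty
  -- The degree `g` determines `k`, so all variables of degree `g` in one copy lie in a single
  -- block. If the component is zero its set is empty and any `k` will do.
  have hcover : ∀ g : G, ∃ k : K, ∀ j, ∀ x ∈ varSet 𝒜 j g, ∃ a, v j k a = x := by
    intro g
    by_cases hg : ∃ a, ∃ k : K, d a * k = g
    · obtain ⟨a, k, rfl⟩ := hg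
      refine ⟨k, fun j x hx => ?_⟩
      obtain ⟨m, hm, rfl⟩ := mem_varSet.1 hx
      obtain ⟨a', k', h1, rfl⟩ := (hdim _ _).1 hm
      obtain rfl := hdK _ _ _ _ h1
      exact ⟨a', by simp only [v, h1]⟩
    · refine ⟨1, fun j x hx => ?_⟩
      obtain ⟨m, hm, rfl⟩ := mem_varSet.1 hx
      obtain ⟨a', k', h1, -⟩ := (hdim _ _).1 hm
      exact absurd ⟨a', k', h1⟩ hg
  have hvmem : ∀ j (k : K) a, v j k a ∈ varSet 𝒜 j (d a * k) := fun j k a =>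
    mem_varSet.2 ⟨l a, (hdim _ _).2 ⟨a, k, rfl, rfl⟩, rfl⟩
  refine ⟨φ, ⟨?_, ?_, ?_, ?_, ?_, ?_⟩, ρ, hρ, c', hc', hcφ⟩
  · intro j g x hx
    obtain ⟨m, _, rfl⟩ := mem_varSet.1 hx
    rfl
  · intro j g
    rw [varSet, card_image_of_injective, card_range]
    intro m m' hm
    exact (Nat.pair_eq_pair.1 (Prod.mk.inj hm).2).2
  · intro i j g hij
    refine Finset.disjoint_left.2 fun x hx hx' => hij ?_
    obtain ⟨m, _, rfl⟩ := mem_varSet.1 hx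
    obtain ⟨m', _, hm⟩ := mem_varSet.1 hx'
    exact Fin.ext (Nat.pair_eq_pair.1 (Prod.mk.inj hm).2).1.symm
  · exact fun j g => Finset.disjoint_empty_right _
  · convert hφ using 1
    rw [union_empty]
    ext x
    simp only [mem_biUnion, mem_univ, true_and, mem_image, Prod.exists]
    constructor
    · rintro ⟨j, g, hx⟩
      obtain ⟨k, hk⟩ := hcover g
      obtain ⟨a, rfl⟩ := hk j x hx
      rcases Nat.even_or_odd' j.1 with ⟨i, hi | hi⟩
      · exact ⟨⟨i, by omega⟩, k, Sum.inl a, by simp only [e, Sum.elim_inl, hi]⟩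
      · exact ⟨⟨i, by omega⟩, k, Sum.inr a, by simp only [e, Sum.elim_inr, hi]⟩
    · rintro ⟨i, k, a | a, rfl⟩
      · exact ⟨⟨2 * i, by omega⟩, _, hvmem _ k a⟩
      · exact ⟨⟨2 * i + 1, by omega⟩, _, hvmem _ k a⟩
  · intro j g
    obtain ⟨k, hk⟩ := hcover g
    have hk := hk j
    rcases Nat.even_or_odd' j.1 with ⟨i, hi | hi⟩
    · rw [hi] at hk
      refine halt (⟨i, by omega⟩, k) (mem_univ _) _ (fun x hx => ?_)
        (isAlternating_regevPoly_left (heinj _) ?_)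
      · obtain ⟨a, rfl⟩ := hk x (hi ▸ hx)
        exact mem_image.2 ⟨Sum.inl a, mem_univ _, rfl⟩
      · exact fun x hx => hk x (hi ▸ hx)
    · rw [hi] at hk
      refine halt (⟨i, by omega⟩, k) (mem_univ _) _ (fun x hx => ?_)
        (isAlternating_regevPoly_right (heinj _) ?_)
      · obtain ⟨a, rfl⟩ := hk x (hi ▸ hx)
        exact mem_image.2 ⟨Sum.inr a, mem_univ _, rfl⟩
      · exact fun x hx => hk x (hi ▸ hx)

end DoubledPolynomial

end GradedPI

theorem lemma4p9 {F G A : Type*} [Field F] [IsAlgClosed F] [CharZero F]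
    [CommGroup G] [Fintype G] [DecidableEq G]
    [NonUnitalRing A] [Module F A] [IsScalarTower F A A] [SMulCommClass F A A]
    [FiniteDimensional F A]
    (𝒜 : G → Submodule F A) (h_grading : GradedPI.IsGrading 𝒜)
    (h_simple : GradedPI.IsGradedSimple 𝒜) (t : ℕ) (ht : 1 ≤ t) :
    ∃ (X : Fin (2 * t) → G → Finset (GradedPI.Var G)) (φ : GradedPI.GradedPoly F G),
      GradedPI.IsFoldAlternating (2 * t) (GradedPI.gDim 𝒜) X ∅ φ ∧
      ¬ GradedPI.IsGradedIdentity 𝒜 φ ∧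
      ∃ ρ : GradedPI.Var G → A, GradedPI.IsGradedSubst 𝒜 ρ ∧
        GradedPI.eval ρ φ ∈ Set.center A ∧ GradedPI.IsInvertible (GradedPI.eval ρ φ) := by
  obtain ⟨a, b, hab⟩ := h_simple.exists_mul_ne_zero
  obtain ⟨n, hn, p, hp⟩ := GradedPI.exists_surjective_matrix (F := F)
    (h_simple.mem_span_mul h_grading) ⟨a * b, hab⟩
  have : NeZero n := ⟨hn⟩
  obtain ⟨φ, hφ, ρ, hρ, c, hc, hpφ⟩ :=
    GradedPI.exists_isFoldAlternating_eval_eq_scalar h_grading h_simple hn p hp t ht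
  refine ⟨_, φ, hφ, fun h0 => ?_, ρ, hρ, GradedPI.mem_center_and_isInvertible h_grading h_simple
    hn p hp (GradedPI.eval_mem_of_isMultilinear h_grading hρ hφ.multilinear) hc hpφ⟩
  rw [h0 ρ hρ, map_zero] at hpφ
  have h1 := congrFun (congrFun hpφ 0) 0
  simp only [Matrix.zero_apply, Matrix.scalar_apply, Matrix.diagonal_apply_eq] at h1
  exact hc h1.symm
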